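/- Let $n\ge 1$, let $N\cong\mathbb Z^n$ be a lattice with dual lattice $M$, and let $S\subseteq M$ be a finitely generated (not necessarily saturated) subsemigroup containing $0$ whose cone $\sigma^\vee=\mathbb R_{\ge0}\cdot S\subseteq M_{\mathbb R}$ contains no line and has full dimension $n$. Let $\sigma\subseteq N_{\mathbb R}$ be the dual cone, let $k$ be a field, put $\mathfrak m_S=(\chi^m : m\in S\setminus\{0\})\subseteq k[S]$, and let $R=k[S]_{\mathfrak m_S}$, the (possibly non-normal) local ring of the affine toric variety $\operatorname{Spec}k[S]$ at its torus-fixed point. An ideal of $R$ is monomial if it is generated by monomials $\chi^m$, $m\in S$. For a monomial ideal $I$ put $E(I)=\{m\in S:\chi^m\in I\}$, let $\mathrm{NP}(I)=\operatorname{conv}(E(I))+\sigma^\vee$ be its Newton polyhedron, and for $u\in\sigma$ let $h_{\mathrm{NP}(I)}(u)=\inf\{\langle u,x\rangle : x\in \mathrm{NP}(I)\}\in[0,\infty]$. For ideals $\mathfrak a,\mathfrak b$ of $R$ let $$\mathcal L_{\mathfrak b}(\mathfrak a)=\inf\Big\{\tfrac qp : p,q\in\mathbb Z_{>0},\ \mathfrak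 b^{qt}\subseteq\overline{\mathfrak a^{pt}}\text{ for all } t\gg0\Big\}\in[0,\infty],$$ where $\overline{\phantom{x}}$ denotes integral closure of ideals. The conventions are $\inf\emptyset=\infty$, and $c/0=\infty$, $c/\infty=0$ for $0<c<\infty$. **Theorem.** Let $\mathfrak a\subseteq R$ be a monomial ideal that is primary to the maximal ideal of $R$, and let $\mathfrak b\subseteq R$ be any monomial ideal. Let $\mathcal N(\mathfrak a)$ be the set of primitive inward normals $u\in\sigma\cap N$ of the compact facets of $\mathrm{NP}(\mathfrak a)$. Then $\mathcal N(\mathfrak a)$ is finite and $$\mathcal L_{\mathfrak b}(\mathfrak a)=\max_{u\in\mathcal N(\mathfrak a)}\frac{h_{\mathrm{NP}(\mathfrak a)}(u)}{h_{\mathrm{NP}(\mathfrak b)}(u)} .$$ Moreover, $\mathcal L_{\mathfrak b}(\mathfrak a)$ is attained by a toric divisorial valuation: there is $u\in\mathcal N(\mathfrak a)$ such that the toric valuation $v_u$ on $R$, given on $k[S]$ by $v_u\big(\sum_m c_m\chi^m\big)=\min\{\langle u,m\rangle : c_m\neq0\}$, is centered at the maximal ideal of $R$, is divisorial (up to a positive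 factor it is the order of vanishing along a prime divisor on a normal scheme birational to $\operatorname{Spec}R$, namely on the normalization of an integral scheme of finite type over $R$), and satisfies $\mathcal L_{\mathfrak b}(\mathfrak a)=v_u(\mathfrak a)/v_u(\mathfrak b)$, where $v_u(I)=\min\{v_u(x):x\in I\}$. -/

import Mathlib

open scoped ENNReal Pointwise

noncomputable section

namespace Lojasiewicz

/-! ### Integral closure of ideals and the algebraic Łojasiewicz exponent -/

section Exponent

variable {R : Type*} [CommRing R]

/-- The integral closure of an ideal `I`: all `x` satisfying an equation
`x ^ d + c₁ x ^ (d - 1) + ⋯ + c_d = 0` with `d ≥ 1` and `cᵢ ∈ I ^ i`. -/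
def idealIntegralClosure (I : Ideal R) : Set R :=
  {x | ∃ d : ℕ, 0 < d ∧ ∃ c : ℕ → R, (∀ i, c i ∈ I ^ i) ∧
    x ^ d + ∑ i ∈ Finset.Icc 1 d, c i * x ^ (d - i) = 0}

/-- The algebraic Łojasiewicz exponent of a filtration `a` with respect to a filtration `b`
(only the members of positive index matter). It lies in `[0, ∞]`, and `inf ∅ = ∞`. -/
def lojFiltration (b a : ℕ → Ideal R) : ℝ≥0∞ :=
  sInf {r | ∃ p q : ℕ, 0 < p ∧ 0 < q ∧ r = (q : ℝ≥0∞) / (p : ℝ≥0∞) ∧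
    ∀ᶠ t : ℕ in Filter.atTop, (b (q * t) : Set R) ⊆ idealIntegralClosure (a (p * t))}

/-- The exponent `L_b(a)` of an ideal `a` with respect to an ideal `b`. -/
def loj (b a : Ideal R) : ℝ≥0∞ :=
  lojFiltration (fun q => b ^ q) (fun p => a ^ p)

/-! ### Valuations -/

/-- The value `v(I) = min {v(x) : x ∈ I}` of a valuation on an ideal. -/
def valIdeal (v : AddValuation R ℝ≥0∞) (I : Ideal R) : ℝ≥0∞ :=
  ⨅ x ∈ I, v x

/-- A valuation `v` on a local ring is centered at the maximal ideal. -/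
def IsCentered [IsLocalRing R] (v : AddValuation R ℝ≥0∞) : Prop :=
  ∀ x ∈ IsLocalRing.maximalIdeal R, 0 < v x

/-- A valuation `v` on a domain `R` is divisorial: up to a positive factor it is the order of
vanishing along a prime divisor of a normal integral scheme that is birational to `Spec R`
and (before normalizing) of finite type over it. On an affine chart this means: there are a finitely
generated `R`-subalgebra `A` of `Frac R` and a height one prime `P` of the integral closure `B` of
`A` in `Frac R` such that the valuation ring of `v` is the discrete valuation ring `B_P`, that is,
`v(x / y) ≥ 0` iff `x / y = b / s` for some `b ∈ B` and `s ∈ B \ P`. -/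
def IsDivisorial [IsDomain R] (v : AddValuation R ℝ≥0∞) : Prop :=
  ∃ A : Subalgebra R (FractionRing R), A.FG ∧
    ∃ P : Ideal (integralClosure A (FractionRing R)), P.IsPrime ∧ P.height = 1 ∧
      ∀ x y : R, y ≠ 0 →
        (v y ≤ v x ↔ ∃ b s : integralClosure A (FractionRing R), s ∉ P ∧
          algebraMap R (FractionRing R) x / algebraMap R (FractionRing R) y
            = (b : FractionRing R) / (s : FractionRing R))

end Exponent

/-! ### Affine semigroups and their cones -/

/-- The inclusion `ℤⁿ → ℝⁿ`. -/
def toReal {n : ℕ} (m : Fin n → ℤ) : Fin n → ℝ := fun i => (m i : ℝ)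

/-- A finitely generated (not necessarily saturated) subsemigroup `S ∋ 0` of the lattice `M = ℤⁿ`
whose cone `ℝ≥0 · S` contains no line and has full dimension `n`. The dual lattice `N` is
identified with `ℤⁿ` through the dot product. -/
structure AffineSemigroup (n : ℕ) where
  carrier : AddSubmonoid (Fin n → ℤ)
  fg : carrier.FG
  pointed : ∀ x ∈ PointedCone.hull ℝ (toReal '' (carrier : Set (Fin n → ℤ))),
    -x ∈ PointedCone.hull ℝ (toReal '' (carrier : Set (Fin n → ℤ))) → x = 0
  full_dim : Submodule.span ℝ (toReal '' (carrier : Set (Fin n → ℤ))) = ⊤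

namespace AffineSemigroup

variable {n : ℕ} (S : AffineSemigroup n) (k : Type*) [Field k]

/-- The cone `σ^∨ = ℝ≥0 · S ⊆ M_ℝ`. -/
def cone : PointedCone ℝ (Fin n → ℝ) :=
  PointedCone.hull ℝ (toReal '' (S.carrier : Set (Fin n → ℤ)))

/-- The dual cone `σ ⊆ N_ℝ`. -/
def dualCone : Set (Fin n → ℝ) := {u | ∀ x ∈ S.cone, 0 ≤ u ⬝ᵥ x}

/-- The affine semigroup ring `k[S]`. -/
abbrev ring : Type _ := AddMonoidAlgebra k S.carrier

/-- The monomial `χ^m`. -/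
def chi (m : S.carrier) : S.ring k := AddMonoidAlgebra.single m 1

/-- The maximal monomial ideal `(χ^m : m ∈ S \ {0})`. -/
def maxMonomialIdeal : Ideal (S.ring k) := Ideal.span (S.chi k '' {m | m ≠ 0})

lemma eq_zero_of_add_eq_zero {m m' : S.carrier} (h : m + m' = 0) : m = 0 := by
  have hm : toReal (m : Fin n → ℤ) = 0 := by
    refine S.pointed _ (Submodule.subset_span ⟨_, m.2, rfl⟩) ?_
    have h2 : -toReal (m : Fin n → ℤ) = toReal (m' : Fin n → ℤ) := by
      have h3 : (m : Fin n → ℤ) + m' = 0 := congrArg Subtype.val h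
      funext i
      have h4 := congrFun h3 i
      simp only [Pi.add_apply, Pi.zero_apply] at h4
      simp only [toReal, Pi.neg_apply]
      have : ((m : Fin n → ℤ) i : ℝ) + ((m' : Fin n → ℤ) i : ℝ) = 0 := by exact_mod_cast h4
      linarith
    rw [h2]
    exact Submodule.subset_span ⟨_, m'.2, rfl⟩
  ext i
  have := congrFun hm i
  simpa [toReal] using this

/-- The point `χ^m ↦ 0` (`m ≠ 0`) of `Spec k[S]`. -/
def fixedPoint : S.ring k →ₐ[k] k :=
  AddMonoidAlgebra.lift k k S.carrier
    { toFun := fun m => if m.toAdd = 0 then 1 else 0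
      map_one' := by simp
      map_mul' := by
        intro a b
        by_cases ha : a.toAdd = 0
        · simp [ha]
        · have : a.toAdd + b.toAdd ≠ 0 := fun h => ha (S.eq_zero_of_add_eq_zero h)
          simp [ha, this] }

lemma fixedPoint_single (m : S.carrier) (c : k) :
    S.fixedPoint k (AddMonoidAlgebra.single m c) = if m = 0 then c else 0 := by
  simp [fixedPoint, AddMonoidAlgebra.lift_single]

lemma maxMonomialIdeal_eq_ker :
    S.maxMonomialIdeal k = RingHom.ker (S.fixedPoint k) := by
  apply le_antisymm
  · rw [maxMonomialIdeal, Ideal.span_le]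
    rintro _ ⟨m, hm, rfl⟩
    have hm' : m ≠ 0 := hm
    simp [RingHom.mem_ker, chi, fixedPoint_single, hm']
  · intro f hf
    have key : ∀ g : S.ring k,
        g - AddMonoidAlgebra.single 0 (S.fixedPoint k g) ∈ S.maxMonomialIdeal k := by
      intro g
      induction g using AddMonoidAlgebra.induction_linear with
      | zero => simp
      | add a b ha hb =>
        have := add_mem ha hb
        rw [map_add, AddMonoidAlgebra.single_add]
        convert this using 1
        abel
      | single m c =>
        rw [fixedPoint_single]
        by_cases hm : m = 0
        · simp [hm]
        · have h1 : (AddMonoidAlgebra.single m c : S.ring k)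
              = AddMonoidAlgebra.single 0 c * S.chi k m := by
            simp [chi, AddMonoidAlgebra.single_mul_single]
          simp only [hm, if_false, AddMonoidAlgebra.single_zero, sub_zero]
          rw [h1]
          exact Ideal.mul_mem_left _ _ (Ideal.subset_span ⟨m, hm, rfl⟩)
    have := key f
    rw [RingHom.mem_ker.1 hf] at this
    simpa using this

instance maxMonomialIdeal_isPrime : (S.maxMonomialIdeal k).IsPrime := by
  rw [maxMonomialIdeal_eq_ker]
  exact RingHom.ker_isPrime _

/-- The local ring `R = k[S]_𝔪` of the affine toric variety `Spec k[S]` at its torus-fixed point. -/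
abbrev localRing : Type _ := Localization.AtPrime (S.maxMonomialIdeal k)

instance ring_isDomain : IsDomain (S.ring k) :=
  haveI : UniqueSums S.carrier :=
    UniqueSums.of_injective_addHom (S.carrier.subtype : AddHom S.carrier (Fin n → ℤ))
      Subtype.val_injective inferInstance
  haveI : NoZeroDivisors (S.ring k) := inferInstance
  NoZeroDivisors.to_isDomain _

instance localRing_isDomain : IsDomain (S.localRing k) :=
  IsLocalization.isDomain_localization (Ideal.primeCompl_le_nonZeroDivisors _)

variable {k}

/-! ### Monomial ideals and Newton polyhedra -/

/-- The image in `R` of the monomial `χ^m`. -/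
def monomial (m : S.carrier) : S.localRing k := algebraMap (S.ring k) (S.localRing k) (S.chi k m)

variable {S}

/-- An ideal of `R` is monomial if it is generated by monomials. -/
def IsMonomial (I : Ideal (S.localRing k)) : Prop :=
  ∃ E : Set S.carrier, I = Ideal.span (S.monomial '' E)

/-- The exponent set `E(I) = {m ∈ S : χ^m ∈ I}`. -/
def exponentSet (I : Ideal (S.localRing k)) : Set (Fin n → ℤ) :=
  {m | ∃ h : m ∈ S.carrier, S.monomial ⟨m, h⟩ ∈ I}

/-- The Newton polyhedron `NP(I) = conv(E(I)) + σ^∨`. -/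
def newtonPolyhedron (I : Ideal (S.localRing k)) : Set (Fin n → ℝ) :=
  convexHull ℝ (toReal '' exponentSet I) + (S.cone : Set (Fin n → ℝ))

variable (S)

/-- The toric valuation `v_u` of `u ∈ σ ∩ N` is the valuation `v` on `R` with
`v(f) = min {⟨u, m⟩ : m ∈ supp f}` for `f ∈ k[S]`; this determines `v`, as elements of `k[S]`
outside the maximal monomial ideal have value `0`. The pairings are nonnegative for `u ∈ σ`. -/
def IsToricValuation (u : Fin n → ℤ) (v : AddValuation (S.localRing k) ℝ≥0∞) : Prop :=
  ∀ f : S.ring k, v (algebraMap (S.ring k) (S.localRing k) f)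
    = ⨅ m ∈ f.coeff.support, ENNReal.ofReal (toReal u ⬝ᵥ toReal (m : Fin n → ℤ))

end AffineSemigroup

/-! ### Support functions and facets -/

section Polyhedra

variable {n : ℕ}

/-- The support function `h_C(u) = inf {⟨u, x⟩ : x ∈ C}`, for `C ⊆ σ^∨` and `u ∈ σ`, so that all
pairings are nonnegative. By convention it is `∞` if `C` is empty. -/
def supportFunction (C : Set (Fin n → ℝ)) (u : Fin n → ℝ) : ℝ≥0∞ :=
  ⨅ x ∈ C, ENNReal.ofReal (u ⬝ᵥ x)

/-- The face of `C` with inward normal `u`, on which `⟨u, ·⟩` is minimal. -/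
def face (C : Set (Fin n → ℝ)) (u : Fin n → ℝ) : Set (Fin n → ℝ) :=
  {x ∈ C | ∀ y ∈ C, u ⬝ᵥ x ≤ u ⬝ᵥ y}

/-- A facet of an `n`-dimensional polyhedron: a nonempty face of dimension `n - 1`. -/
def IsFacet (C F : Set (Fin n → ℝ)) : Prop :=
  F.Nonempty ∧ (∃ u, F = face C u) ∧ Module.finrank ℝ (vectorSpan ℝ F) + 1 = n

/-- A lattice vector is primitive if it is not a multiple of another one by a non-unit. -/
def IsPrimitiveVector (u : Fin n → ℤ) : Prop :=
  ∀ (d : ℤ) (w : Fin n → ℤ), u = d • w → IsUnit d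

/-- The set `𝒩(a)` of primitive inward normals `u ∈ σ ∩ N` of the compact facets of `NP(a)`. -/
def facetNormals {S : AffineSemigroup n} {k : Type*} [Field k] (a : Ideal (S.localRing k)) :
    Set (Fin n → ℤ) :=
  {u | IsPrimitiveVector u ∧ toReal u ∈ S.dualCone ∧
    ∃ F, IsFacet (AffineSemigroup.newtonPolyhedron a) F ∧ IsCompact F ∧
      F = face (AffineSemigroup.newtonPolyhedron a) (toReal u)}

end Polyhedra

end Lojasiewicz

end

open scoped ENNReal Pointwise

noncomputable section

namespace Lojasiewicz

/-! ### Blocking polyhedra, their vertices and compact facets. -/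

section Convex

variable {n : ℕ} {ι : Type*} [Fintype ι]

/-! For fixed positive `p`, `q`, the inclusion of `b ^ (q t)` in the integral closure of `a ^ (p t)`
is decided by finitely many linear inequalities: it holds for large `t` if and only if `p h_a(u) ≤ q
h_b(u)` for every normal `u` of a compact facet of `NP(a)` (`eventually_subset_iff`). The exponent
is thus the infimum of the positive rationals above the finitely many ratios `h_a(u) / h_b(u)`,
which is their maximum.

Necessity is the easy half of the valuative criterion. A lower bound for `v_u` on an ideal persists
on its integral closure (`le_of_mem_idealIntegralClosure`), and `v_u` takes the value `h_I(u)` on a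
monomial ideal `I`.

Sufficiency is convex geometry followed by clearing denominators. Since `a` is primary to the
maximal ideal, finitely many exponents `f i` of `a` generate the cone `σ^∨` and satisfy `NP(a) = {∑
c i • f i : c ≥ 0, ∑ c i ≥ 1}`. A point of the cone lies in this set as soon as `1 ≤ v ⬝ᵥ x` for
every vertex `v` of the blocking polyhedron `{v : v ⬝ᵥ f i ≥ 1}`: separate by a point of the
blocker, then slide that point to a vertex (`mem_upperHull_of_forall_vertex`). These vertices are,
up to positive scaling, exactly the normals of the compact facets. So the inequalities place an
exponent `m` in `N • NP(a)`, and a pigeonhole argument turns the real coefficients into an identity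
`D m = ∑ d i f i` with `∑ d i ≥ D N`. Then `(χ^m) ^ D ∈ (a ^ N) ^ D`, whence `χ^m` is integral over
`a ^ N`.

For the divisorial statement, `v_u` is the order of the expansion of an element into pieces graded
by `u`. Quotients of monomials of nonnegative weight form a finitely generated monoid; adjoining
them to `R` gives a model on which `v_u` has a center of height one. -/

/-- The polyhedron `conv(f) + cone(f)` when all `f i` span the recession cone. -/
def upperHull (f : ι → Fin n → ℝ) : Set (Fin n → ℝ) :=
  {x | ∃ c : ι → ℝ, (∀ i, 0 ≤ c i) ∧ 1 ≤ ∑ i, c i ∧ x = ∑ i, c i • f i}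

/-- The blocking polyhedron of `upperHull f`. -/
def blocker (f : ι → Fin n → ℝ) : Set (Fin n → ℝ) := {u | ∀ i, 1 ≤ u ⬝ᵥ f i}

/-- The points where the constraints of the blocker that are tight at `u` are attained. -/
def tightSpan (f : ι → Fin n → ℝ) (u : Fin n → ℝ) : Submodule ℝ (Fin n → ℝ) :=
  Submodule.span ℝ (f '' {i | u ⬝ᵥ f i = 1})

lemma dotProduct_sum_smul (f : ι → Fin n → ℝ) (c : ι → ℝ) (u : Fin n → ℝ) :
    u ⬝ᵥ (∑ i, c i • f i) = ∑ i, c i * (u ⬝ᵥ f i) := by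
  simp [dotProduct_sum, dotProduct_smul]

lemma exists_dotProduct_of_continuousLinearMap (g : (Fin n → ℝ) →L[ℝ] ℝ) :
    ∃ u : Fin n → ℝ, ∀ x, g x = u ⬝ᵥ x := by
  refine ⟨fun i => g (Pi.single i 1), fun x => ?_⟩
  conv_lhs => rw [pi_eq_sum_univ' x]
  simp [dotProduct, mul_comm]

lemma mem_convexHull_range_iff (f : ι → Fin n → ℝ) (x : Fin n → ℝ) :
    x ∈ convexHull ℝ (Set.range f) ↔
      ∃ c : ι → ℝ, (∀ i, 0 ≤ c i) ∧ ∑ i, c i = 1 ∧ x = ∑ i, c i • f i := by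
  rw [convexHull_range_eq_exists_affineCombination]
  constructor
  · rintro ⟨s, w, h0, h1, rfl⟩
    classical
    refine ⟨fun i => if i ∈ s then w i else 0, fun i => ?_, ?_, ?_⟩
    · dsimp only; split_ifs with h
      exacts [h0 i h, le_rfl]
    · simpa using h1
    · rw [Finset.affineCombination_eq_linear_combination s f w h1]
      simp [ite_smul]
  · rintro ⟨c, h0, h1, rfl⟩
    exact ⟨Finset.univ, c, fun i _ => h0 i, h1,
      Finset.affineCombination_eq_linear_combination _ f c h1⟩

/-- Hahn–Banach separates the segment from `0` to `x` from the convex hull of the `f i`. Including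
`0` in the segment forces the separating level `s` to be positive, so that the functional can be
rescaled to level `1`. If `t • x` were in the hull with `0 < t ≤ 1`, dividing the coefficients by
`t` would give `x ∈ upperHull f`. -/
lemma exists_mem_blocker_lt (f : ι → Fin n → ℝ) (h0 : (0 : Fin n → ℝ) ∉ convexHull ℝ (Set.range f))
    {x : Fin n → ℝ} (hx : x ∉ upperHull f) :
    ∃ u ∈ blocker f, u ⬝ᵥ x < 1 := by
  have hdisj : Disjoint (segment ℝ 0 x) (convexHull ℝ (Set.range f)) := by
    rw [Set.disjoint_left]
    intro y hy hyK
    rw [segment_eq_image' ℝ] at hy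
    obtain ⟨t, ⟨ht0, ht1⟩, rfl⟩ := hy
    simp only [sub_zero, zero_add] at hyK
    rcases ht0.eq_or_lt with rfl | ht
    · simp at hyK; exact h0 hyK
    obtain ⟨d, hd0, hd1, hd⟩ := (mem_convexHull_range_iff f _).1 hyK
    apply hx
    refine ⟨fun i => t⁻¹ * d i, fun i => mul_nonneg (inv_nonneg.2 ht.le) (hd0 i), ?_, ?_⟩
    · rw [← Finset.mul_sum, hd1, mul_one]
      exact (one_le_inv₀ ht).2 ht1
    · simp_rw [mul_smul]
      rw [← Finset.smul_sum, ← hd, smul_smul, inv_mul_cancel₀ ht.ne', one_smul]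
  obtain ⟨g, s, t, hs, hst, ht⟩ := geometric_hahn_banach_compact_closed
    (convex_segment (𝕜 := ℝ) 0 x)
    (by rw [← convexHull_pair (𝕜 := ℝ)]; exact (Set.toFinite _).isCompact_convexHull (𝕜 := ℝ))
    (convex_convexHull ℝ _) ((Set.finite_range f).isCompact_convexHull (𝕜 := ℝ)).isClosed hdisj
  obtain ⟨w, hw⟩ := exists_dotProduct_of_continuousLinearMap g
  have hs0 : 0 < s := by simpa using hs 0 (left_mem_segment ℝ 0 x)
  have hsx : w ⬝ᵥ x < s := by simpa [hw] using hs x (right_mem_segment ℝ 0 x)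
  have ht' : ∀ i, s < w ⬝ᵥ f i := fun i => by
    have := ht _ (subset_convexHull ℝ _ ⟨i, rfl⟩)
    rw [hw] at this; linarith
  refine ⟨s⁻¹ • w, fun i => ?_, ?_⟩
  · rw [smul_dotProduct, smul_eq_mul, inv_mul_eq_div, le_div_iff₀ hs0]
    linarith [ht' i]
  · rw [smul_dotProduct, smul_eq_mul, inv_mul_eq_div, div_lt_iff₀ hs0]
    linarith

lemma exists_dotProduct_eq_zero {V : Submodule ℝ (Fin n → ℝ)} (hV : V ≠ ⊤) :
    ∃ w : Fin n → ℝ, w ≠ 0 ∧ ∀ x ∈ V, w ⬝ᵥ x = 0 := by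
  obtain ⟨g, hg0, hg⟩ := Submodule.exists_le_ker_of_lt_top V (lt_top_iff_ne_top.2 hV)
  obtain ⟨w, hw⟩ := exists_dotProduct_of_continuousLinearMap (LinearMap.toContinuousLinearMap g)
  refine ⟨w, ?_, fun x hx => ?_⟩
  · rintro rfl
    exact hg0 (LinearMap.ext fun x => by simpa using hw x)
  · rw [← hw]; exact hg hx

lemma eq_zero_of_dotProduct_eq_zero_of_span {s : Set (Fin n → ℝ)} (hs : Submodule.span ℝ s = ⊤)
    {w : Fin n → ℝ} (hw : ∀ x ∈ s, w ⬝ᵥ x = 0) : w = 0 := by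
  have : ∀ x ∈ Submodule.span ℝ s, w ⬝ᵥ x = 0 := by
    intro x hx
    induction hx using Submodule.span_induction with
    | mem x h => exact hw x h
    | zero => simp
    | add x y _ _ h1 h2 => rw [dotProduct_add, h1, h2, add_zero]
    | smul a x _ h => rw [dotProduct_smul, h, smul_zero]
  rw [hs] at this
  exact dotProduct_self_eq_zero.1 (this w trivial)

/-- Along a direction orthogonal to the tight constraints, decreasing some constraint, the tight
span grows. -/
lemma exists_tightSpan_lt (f : ι → Fin n → ℝ) {u w : Fin n → ℝ} (hu : u ∈ blocker f)
    (hw : ∀ x ∈ tightSpan f u, w ⬝ᵥ x = 0) (hneg : ∃ i, w ⬝ᵥ f i < 0) :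
    ∃ s : ℝ, 0 ≤ s ∧ u + s • w ∈ blocker f ∧ tightSpan f u < tightSpan f (u + s • w) := by
  classical
  let J : Finset ι := Finset.univ.filter fun i => w ⬝ᵥ f i < 0
  have hJ : J.Nonempty := by obtain ⟨i, hi⟩ := hneg; exact ⟨i, by simpa [J] using hi⟩
  -- Ratio test: `s` is the largest step along `w` that violates no constraint. The constraint `i₀`
  -- that becomes tight is not orthogonal to `w`, so `f i₀` is outside the old tight span.
  obtain ⟨i₀, hi₀, hmin⟩ := J.exists_min_image (fun i => (u ⬝ᵥ f i - 1) / -(w ⬝ᵥ f i)) hJ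
  have hi₀' : w ⬝ᵥ f i₀ < 0 := by simpa [J] using hi₀
  set s := (u ⬝ᵥ f i₀ - 1) / -(w ⬝ᵥ f i₀) with hsdef
  have hs : 0 ≤ s := div_nonneg (by linarith [hu i₀]) (by linarith)
  have hval : ∀ i, (u + s • w) ⬝ᵥ f i = u ⬝ᵥ f i + s * (w ⬝ᵥ f i) := fun i => by
    rw [add_dotProduct, smul_dotProduct, smul_eq_mul]
  have htight : (u + s • w) ⬝ᵥ f i₀ = 1 := by
    rw [hval, hsdef]
    have := hi₀'.ne
    generalize w ⬝ᵥ f i₀ = p at this ⊢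
    field_simp
    ring
  refine ⟨s, hs, fun i => ?_, lt_of_le_of_ne ?_ ?_⟩
  · rw [hval]
    by_cases hi : w ⬝ᵥ f i < 0
    · have := hmin i (by simpa [J] using hi)
      rw [le_div_iff₀ (by linarith)] at this
      linarith
    · have := mul_nonneg hs (not_lt.1 hi)
      linarith [hu i]
  · apply Submodule.span_mono
    apply Set.image_mono
    intro i hi
    have hi' : u ⬝ᵥ f i = 1 := hi
    have : w ⬝ᵥ f i = 0 := hw _ (Submodule.subset_span ⟨i, hi, rfl⟩)
    change (u + s • w) ⬝ᵥ f i = 1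
    rw [hval, this, hi', mul_zero, add_zero]
  · intro h
    have : f i₀ ∈ tightSpan f u := by
      rw [h]; exact Submodule.subset_span ⟨i₀, htight, rfl⟩
    exact hi₀'.ne (hw _ this)

/-- A linear functional that is bounded below on the blocker is minimized at a vertex. -/
lemma exists_vertex_le (f : ι → Fin n → ℝ) (hf : Submodule.span ℝ (Set.range f) = ⊤)
    {c : ι → ℝ} (hc : ∀ i, 0 ≤ c i) (u₀ : Fin n → ℝ) (hu₀ : u₀ ∈ blocker f) :
    ∃ u ∈ blocker f, tightSpan f u = ⊤ ∧
      u ⬝ᵥ (∑ i, c i • f i) ≤ u₀ ⬝ᵥ (∑ i, c i • f i) := by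
  set x := ∑ i, c i • f i with hx
  -- Induction along growing tight spans, which terminates in finite dimension.
  induction hV : tightSpan f u₀ using WellFoundedGT.induction generalizing u₀ with
  | ind V ih =>
    by_cases htop : V = ⊤
    · exact ⟨u₀, hu₀, hV.trans htop, le_rfl⟩
    -- Choose the sign of `w` so that `w ⬝ᵥ x ≤ 0`. If `w` decreases no constraint, then `w ⬝ᵥ x =
    -- 0` because `x` is in the cone of the `f i`, so `-w` is equally good; it decreases some
    -- constraint because the `f i` span.
    have key : ∃ w : Fin n → ℝ, (∀ y ∈ tightSpan f u₀, w ⬝ᵥ y = 0) ∧ (∃ i, w ⬝ᵥ f i < 0) ∧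
        w ⬝ᵥ x ≤ 0 := by
      obtain ⟨w, hw0, hw⟩ : ∃ w : Fin n → ℝ, w ≠ 0 ∧ ∀ y ∈ V, w ⬝ᵥ y = 0 :=
        exists_dotProduct_eq_zero htop
      wlog hwx : w ⬝ᵥ x ≤ 0 generalizing w
      · exact this (-w) (by simpa using hw0) (fun y hy => by simp [hw y hy])
          (by rw [neg_dotProduct]; linarith)
      by_cases hneg : ∃ i, w ⬝ᵥ f i < 0
      · exact ⟨w, by rwa [hV], hneg, hwx⟩
      push Not at hneg
      have hx0 : 0 ≤ w ⬝ᵥ x := by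
        rw [hx, dotProduct_sum_smul]
        exact Finset.sum_nonneg fun i _ => mul_nonneg (hc i) (hneg i)
      refine ⟨-w, fun y hy => by rw [hV] at hy; simp [hw y hy], ?_, by
        rw [neg_dotProduct]; linarith⟩
      by_contra! hcon
      apply hw0
      apply eq_zero_of_dotProduct_eq_zero_of_span hf
      rintro _ ⟨i, rfl⟩
      have := hcon i
      rw [neg_dotProduct] at this
      linarith [hneg i]
    obtain ⟨w, hw, hneg, hwx⟩ := key
    obtain ⟨s, hs, hmem, hlt⟩ := exists_tightSpan_lt f hu₀ hw hneg
    obtain ⟨u, hu, hut, hle⟩ := ih _ (hV ▸ hlt) (u₀ + s • w) hmem rfl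
    refine ⟨u, hu, hut, hle.trans ?_⟩
    rw [add_dotProduct, smul_dotProduct, smul_eq_mul]
    nlinarith

lemma mem_upperHull_of_forall_vertex (f : ι → Fin n → ℝ)
    (hf : Submodule.span ℝ (Set.range f) = ⊤)
    (h0 : (0 : Fin n → ℝ) ∉ convexHull ℝ (Set.range f)) {c : ι → ℝ} (hc : ∀ i, 0 ≤ c i)
    (hx : ∀ u ∈ blocker f, tightSpan f u = ⊤ → 1 ≤ u ⬝ᵥ (∑ i, c i • f i)) :
    ∑ i, c i • f i ∈ upperHull f := by
  by_contra hcon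
  obtain ⟨u₀, hu₀, hlt⟩ := exists_mem_blocker_lt f h0 hcon
  obtain ⟨u, hu, hut, hle⟩ := exists_vertex_le f hf hc u₀ hu₀
  linarith [hx u hu hut]

/-- Separating the origin from `upperHull f` shows that the blocker is nonempty; minimizing the zero
functional over it then produces a vertex. -/
lemma exists_vertex (f : ι → Fin n → ℝ) (hf : Submodule.span ℝ (Set.range f) = ⊤)
    (h0 : (0 : Fin n → ℝ) ∉ convexHull ℝ (Set.range f)) :
    ∃ u ∈ blocker f, tightSpan f u = ⊤ := by
  have h : ∑ i, (0 : ι → ℝ) i • f i ∉ upperHull f := by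
    rintro ⟨c, hc, h1, hx⟩
    apply h0
    rw [mem_convexHull_range_iff]
    refine ⟨fun i => (∑ j, c j)⁻¹ * c i, fun i => mul_nonneg (by positivity) (hc i), ?_, ?_⟩
    · rw [← Finset.mul_sum, inv_mul_cancel₀ (by linarith)]
    · simp_rw [mul_smul]
      rw [← Finset.smul_sum, ← hx]
      simp
  obtain ⟨u₀, hu₀, -⟩ := exists_mem_blocker_lt f h0 h
  obtain ⟨u, hu, hut, -⟩ := exists_vertex_le f hf (c := 0) (fun _ => le_rfl) u₀ hu₀
  exact ⟨u, hu, hut⟩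

lemma tight_nonempty {f : ι → Fin n → ℝ} {u : Fin n → ℝ} (hn : 1 ≤ n)
    (hut : tightSpan f u = ⊤) : ∃ i, u ⬝ᵥ f i = 1 := by
  by_contra! h
  have : {i | u ⬝ᵥ f i = 1} = ∅ := by ext i; simpa using h i
  rw [tightSpan, this, Set.image_empty, Submodule.span_empty] at hut
  have : Nonempty (Fin n) := ⟨⟨0, hn⟩⟩
  exact bot_ne_top hut

lemma one_le_dotProduct_of_mem_upperHull {f : ι → Fin n → ℝ} {u x : Fin n → ℝ}
    (hu : u ∈ blocker f) (hx : x ∈ upperHull f) : 1 ≤ u ⬝ᵥ x := by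
  obtain ⟨c, hc, h1, rfl⟩ := hx
  rw [dotProduct_sum_smul]
  exact h1.trans (Finset.sum_le_sum fun i _ => le_mul_of_one_le_right (hc i) (hu i))

lemma mem_upperHull_self (f : ι → Fin n → ℝ) (i : ι) : f i ∈ upperHull f := by
  classical
  exact ⟨Pi.single i 1, fun j => by by_cases h : j = i <;> simp [h], by simp,
    by simp [Pi.single_apply, ite_smul]⟩

/-- A point where `u` takes its minimum `1` satisfies `1 ≤ ∑ c i ≤ ∑ c i * (u ⬝ᵥ f i) ≤ 1`. Equality
termwise kills every coefficient at a non-tight index. -/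
lemma face_upperHull {f : ι → Fin n → ℝ} {u : Fin n → ℝ} (hu : u ∈ blocker f)
    (ht : ∃ i, u ⬝ᵥ f i = 1) :
    face (upperHull f) u = convexHull ℝ (f '' {i | u ⬝ᵥ f i = 1}) := by
  apply Set.Subset.antisymm
  · rintro x ⟨hx, hmin⟩
    obtain ⟨i₀, hi₀⟩ := ht
    have hle := hmin _ (mem_upperHull_self f i₀)
    obtain ⟨c, hc, h1, rfl⟩ := hx
    rw [hi₀, dotProduct_sum_smul] at hle
    have hterm : ∀ i ∈ Finset.univ, c i ≤ c i * (u ⬝ᵥ f i) :=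
      fun i _ => le_mul_of_one_le_right (hc i) (hu i)
    have hsum : ∑ i, c i = 1 := le_antisymm ((Finset.sum_le_sum hterm).trans hle) h1
    have heq : ∑ i, c i = ∑ i, c i * (u ⬝ᵥ f i) :=
      le_antisymm (Finset.sum_le_sum hterm) (hle.trans h1)
    have hall := (Finset.sum_eq_sum_iff_of_le hterm).1 heq
    have hzero : ∀ i, ¬ u ⬝ᵥ f i = 1 → c i = 0 := by
      intro i hi
      by_contra hci
      exact hi (mul_left_cancel₀ hci (by rw [mul_one]; exact (hall i (Finset.mem_univ i)).symm))
    classical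
    have hs1 : ∑ i with u ⬝ᵥ f i = 1, c i = 1 := by
      rw [Finset.sum_filter]
      refine (Finset.sum_congr rfl fun i _ => ?_).trans hsum
      split_ifs with h
      exacts [rfl, (hzero i h).symm]
    have hs2 : ∑ i with u ⬝ᵥ f i = 1, c i • f i = ∑ i, c i • f i := by
      rw [Finset.sum_filter]
      refine Finset.sum_congr rfl fun i _ => ?_
      split_ifs with h
      exacts [rfl, by rw [hzero i h, zero_smul]]
    rw [← hs2]
    refine (convex_convexHull ℝ _).sum_mem (fun i _ => hc i) hs1 fun i hi =>
      subset_convexHull ℝ _ ⟨i, by simpa using hi, rfl⟩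
  · intro x hx
    have h1 : u ⬝ᵥ x = 1 := by
      have : convexHull ℝ (f '' {i | u ⬝ᵥ f i = 1}) ⊆ {y | u ⬝ᵥ y = 1} := by
        refine convexHull_min ?_ ?_
        · rintro _ ⟨i, hi, rfl⟩; exact hi
        · intro y hy z hz a b _ _ hab
          have hy' : u ⬝ᵥ y = 1 := hy
          have hz' : u ⬝ᵥ z = 1 := hz
          simp [dotProduct_add, dotProduct_smul, hy', hz', hab]
      exact this hx
    refine ⟨?_, fun y hy => h1 ▸ one_le_dotProduct_of_mem_upperHull hu hy⟩
    obtain ⟨c, hc, hc1, rfl⟩ := (mem_convexHull_range_iff f x).1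
      (convexHull_mono (Set.image_subset_range _ _) hx)
    exact ⟨c, hc, hc1.ge, rfl⟩

/-- `T` lies in an affine hyperplane missing the origin, so its linear span is the direct sum of its
direction space and the line through any one of its points. Facets thereby correspond to vertices of
the blocker. -/
lemma finrank_vectorSpan_convexHull {T : Set (Fin n → ℝ)} {u : Fin n → ℝ}
    (hT : ∀ x ∈ T, u ⬝ᵥ x = 1) (hne : T.Nonempty) :
    Module.finrank ℝ (vectorSpan ℝ (convexHull ℝ T)) + 1 = n ↔ Submodule.span ℝ T = ⊤ := by
  obtain ⟨t, ht⟩ := hne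
  rw [← direction_affineSpan, affineSpan_convexHull, direction_affineSpan]
  have hVu : ∀ x ∈ vectorSpan ℝ T, u ⬝ᵥ x = 0 := by
    intro x hx
    induction hx using Submodule.span_induction with
    | mem x h =>
      obtain ⟨y, hy, z, hz, rfl⟩ := Set.mem_vsub.1 h
      rw [vsub_eq_sub, dotProduct_sub, hT y hy, hT z hz, sub_self]
    | zero => simp
    | add x y _ _ h1 h2 => rw [dotProduct_add, h1, h2, add_zero]
    | smul a x _ h => rw [dotProduct_smul, h, smul_zero]
  have htV : t ∉ vectorSpan ℝ T := fun h => by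
    have := hVu t h
    rw [hT t ht] at this
    exact one_ne_zero this
  have hsup : Submodule.span ℝ T = vectorSpan ℝ T ⊔ Submodule.span ℝ {t} := by
    apply le_antisymm
    · rw [Submodule.span_le]
      intro x hx
      have : x = (x -ᵥ t) + t := by simp
      rw [this]
      exact Submodule.add_mem_sup (vsub_mem_vectorSpan ℝ hx ht) (Submodule.mem_span_singleton_self t)
    · refine sup_le ?_ (Submodule.span_mono (Set.singleton_subset_iff.2 ht))
      rw [vectorSpan, Submodule.span_le]
      intro x hx
      obtain ⟨y, hy, z, hz, rfl⟩ := Set.mem_vsub.1 hx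
      exact sub_mem (Submodule.subset_span hy) (Submodule.subset_span hz)
  have hrank : Module.finrank ℝ (Submodule.span ℝ T) = Module.finrank ℝ (vectorSpan ℝ T) + 1 := by
    rw [hsup]
    have ht0 : t ≠ 0 := fun h => htV (h ▸ zero_mem _)
    have hdis : Disjoint (vectorSpan ℝ T) (Submodule.span ℝ {t}) := by
      rw [Submodule.disjoint_span_singleton' ht0]; exact htV
    have := Submodule.finrank_sup_add_finrank_inf_eq (vectorSpan ℝ T) (Submodule.span ℝ {t})
    rw [hdis.eq_bot, finrank_bot, finrank_span_singleton ht0] at this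
    omega
  rw [← hrank]
  constructor
  · intro h
    exact Submodule.eq_top_of_finrank_eq (by simpa using h)
  · intro h
    rw [h]; simp

end Convex

/-! ### Rationality: integral coefficients and primitive normals. -/

section Integrality

variable {n : ℕ} {ι κ : Type*} [Fintype ι] [Fintype κ]

/-- An integral vector in the real cone of integral vectors lies in their rational cone. -/
lemma exists_pos_mul_eq_sum (z : ι → κ → ℤ) (w : κ → ℤ) {c : ι → ℝ} (hc : ∀ i, 0 ≤ c i)
    (h : ∀ j, (w j : ℝ) = ∑ i, c i * z i j) :
    ∃ D : ℕ, 0 < D ∧ ∃ d : ι → ℕ, ∀ j, (D : ℤ) * w j = ∑ i, (d i : ℤ) * z i j := by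
  classical
  -- Pigeonhole: the remainders of `N • w` after rounding down the coefficients are integral vectors
  -- in a fixed box, so two of them agree. Their difference is the required relation, with `D = N' -
  -- N`.
  let r : ℕ → κ → ℤ := fun N j => N * w j - ∑ i, ⌊(N : ℝ) * c i⌋ * z i j
  have hr : ∀ N, r N ∈ Set.Icc (fun j => -∑ i, |z i j|) (fun j => ∑ i, |z i j|) := by
    intro N
    have hb : ∀ j, |r N j| ≤ ∑ i, |z i j| := by
      intro j
      have h1 : (r N j : ℝ) = ∑ i, Int.fract ((N : ℝ) * c i) * z i j := by
        simp only [r, Int.fract, sub_mul, Finset.sum_sub_distrib]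
        push_cast
        rw [h j, Finset.mul_sum]
        simp only [mul_assoc]
      have h2 : |(r N j : ℝ)| ≤ ∑ i, |(z i j : ℝ)| := by
        rw [h1]
        refine (Finset.abs_sum_le_sum_abs _ _).trans (Finset.sum_le_sum fun i _ => ?_)
        rw [abs_mul, abs_of_nonneg (Int.fract_nonneg _)]
        exact mul_le_of_le_one_left (abs_nonneg _) (Int.fract_lt_one _).le
      exact_mod_cast h2
    exact ⟨fun j => (abs_le.1 (hb j)).1, fun j => (abs_le.1 (hb j)).2⟩
  have hfin : Finite (Set.Icc (fun j => -∑ i, |z i j|) (fun j => ∑ i, |z i j|)) :=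
    (Set.finite_Icc _ _).to_subtype
  obtain ⟨N, N', hne, heq⟩ := Finite.exists_ne_map_eq_of_infinite
    (fun N => (⟨r N, hr N⟩ : Set.Icc (fun j => -∑ i, |z i j|) (fun j => ∑ i, |z i j|)))
  wlog hlt : N < N' generalizing N N'
  · exact this N' N hne.symm heq.symm (by omega)
  have hrr : r N = r N' := congrArg Subtype.val heq
  have hmono : ∀ i, ⌊(N : ℝ) * c i⌋ ≤ ⌊(N' : ℝ) * c i⌋ := fun i =>
    Int.floor_le_floor (mul_le_mul_of_nonneg_right (by exact_mod_cast hlt.le) (hc i))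
  refine ⟨N' - N, by omega, fun i => (⌊(N' : ℝ) * c i⌋ - ⌊(N : ℝ) * c i⌋).toNat, fun j => ?_⟩
  have hj := congrFun hrr j
  simp only [r] at hj
  have : ∀ i, (((⌊(N' : ℝ) * c i⌋ - ⌊(N : ℝ) * c i⌋).toNat : ℕ) : ℤ)
      = ⌊(N' : ℝ) * c i⌋ - ⌊(N : ℝ) * c i⌋ := fun i =>
    Int.toNat_of_nonneg (sub_nonneg.2 (hmono i))
  simp only [this, sub_mul, Finset.sum_sub_distrib]
  rw [Nat.cast_sub hlt.le, sub_mul]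
  linarith

lemma toReal_dotProduct (u w : Fin n → ℤ) : toReal u ⬝ᵥ toReal w = ((u ⬝ᵥ w : ℤ) : ℝ) := by
  simp [toReal, dotProduct]

lemma toReal_add (u w : Fin n → ℤ) : toReal (u + w) = toReal u + toReal w := by
  ext; simp [toReal]

lemma toReal_zero : toReal (0 : Fin n → ℤ) = 0 := by
  ext; simp [toReal]

lemma toReal_nsmul (a : ℕ) (w : Fin n → ℤ) : toReal (a • w) = (a : ℝ) • toReal w := by
  ext; simp [toReal]

lemma toReal_injective : Function.Injective (toReal (n := n)) := fun u w h => by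
  ext i
  have := congrFun h i
  simpa [toReal] using this

lemma exists_primitiveVector {w : Fin n → ℤ} (hw : w ≠ 0) :
    ∃ w' : Fin n → ℤ, IsPrimitiveVector w' ∧ ∃ d : ℤ, 0 < d ∧ w = d • w' := by
  obtain ⟨j, hj⟩ := Function.ne_iff.1 hw
  obtain ⟨g, hg, hg1⟩ := Finset.extract_gcd w (s := Finset.univ) ⟨j, Finset.mem_univ j⟩
  refine ⟨g, fun d v hd => ?_, Finset.univ.gcd w, ?_, ?_⟩
  · apply isUnit_of_dvd_one
    rw [← hg1]
    exact Finset.dvd_gcd fun i _ => ⟨v i, by rw [hd]; simp⟩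
  · have h0 : Finset.univ.gcd w ≠ 0 := fun h => hj (Finset.gcd_eq_zero_iff.1 h j (Finset.mem_univ j))
    have h1 : normalize (Finset.univ.gcd w) = Finset.univ.gcd w := Finset.normalize_gcd
    have := Int.nonneg_of_normalize_eq_self h1
    omega
  · ext i
    simpa using hg i (Finset.mem_univ i)

lemma IsPrimitiveVector.ne_zero {w : Fin n → ℤ} (hw : IsPrimitiveVector w) : w ≠ 0 := by
  rintro rfl
  simpa using hw 0 0 (by simp)

lemma IsPrimitiveVector.isUnit_of_mul_eq {w w' : Fin n → ℤ} (hw : IsPrimitiveVector w) {p q : ℤ}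
    (hpq : IsCoprime p q) (h : ∀ i, p * w i = q * w' i) : IsUnit q := by
  have hdvd : ∀ i, q ∣ w i := fun i => hpq.symm.dvd_of_dvd_mul_left ⟨w' i, h i⟩
  choose v hv using hdvd
  exact hw q v (funext fun i => by simp [hv i])

/-- Parallel integral vectors satisfy `p w = q w'` with `p`, `q` coprime. Primitivity makes both
units, and `c > 0` excludes the opposite sign. -/
lemma IsPrimitiveVector.eq_of_smul {w w' : Fin n → ℤ} (hw : IsPrimitiveVector w)
    (hw' : IsPrimitiveVector w') {c : ℝ} (hc : 0 < c) (h : toReal w = c • toReal w') : w = w' := by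
  obtain ⟨j, hj⟩ := Function.ne_iff.1 hw'.ne_zero
  have hcomp : ∀ i, (w i : ℝ) = c * w' i := fun i => by simpa [toReal] using congrFun h i
  have hcross : ∀ i, w' j * w i = w j * w' i := fun i => by
    have : (w' j : ℝ) * w i = w j * w' i := by rw [hcomp i, hcomp j]; ring
    exact_mod_cast this
  have hg0 : 0 < Int.gcd (w' j) (w j) := Int.gcd_pos_of_ne_zero_left _ hj
  obtain ⟨p, q, hcop, hp, hq⟩ := Int.exists_gcd_one hg0
  generalize Int.gcd (w' j) (w j) = g at hg0 hp hq
  have hcop' : IsCoprime p q := Int.isCoprime_iff_gcd_eq_one.2 hcop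
  have hg0' : (g : ℤ) ≠ 0 := by exact_mod_cast hg0.ne'
  have hmain : ∀ i, p * w i = q * w' i := fun i => by
    have := hcross i
    rw [hp, hq] at this
    apply mul_right_cancel₀ hg0'
    linarith
  have hq1 := Int.isUnit_iff.1 (hw.isUnit_of_mul_eq hcop' hmain)
  have hp1 := Int.isUnit_iff.1 (hw'.isUnit_of_mul_eq hcop'.symm fun i => (hmain i).symm)
  have hneg : ¬ w = -w' := by
    intro hcon
    have h1 := hcomp j
    rw [hcon] at h1
    have h2 : (c + 1) * (w' j : ℝ) = 0 := by
      simp only [Pi.neg_apply, Int.cast_neg] at h1; linarith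
    rcases mul_eq_zero.1 h2 with h3 | h3
    · linarith
    · exact hj (by exact_mod_cast h3)
  rcases hp1 with rfl | rfl <;> rcases hq1 with rfl | rfl
  · ext i; simpa using hmain i
  · exact absurd (funext fun i => by simpa using hmain i) hneg
  · exact absurd (funext fun i => by have := hmain i; simp only [Pi.neg_apply]; linarith) hneg
  · ext i; have := hmain i; linarith

/-- Cramer's rule: a vertex solves `A u = 1` for an invertible integral matrix `A` whose rows are
tight exponents, so `det A • u` is integral. Adjust the sign and divide by the gcd of the entries.
-/
lemma exists_primitive_normal (f : ι → Fin n → ℤ) (hn : 1 ≤ n) {u : Fin n → ℝ}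
    (hut : tightSpan (fun i => toReal (f i)) u = ⊤) :
    ∃ w : Fin n → ℤ, IsPrimitiveVector w ∧ ∃ c : ℝ, 0 < c ∧ toReal w = c • u := by
  have hu0 : u ≠ 0 := by
    rintro rfl
    obtain ⟨i, hi⟩ := tight_nonempty hn hut
    simp at hi
  obtain ⟨b, hbs, hbspan, hbli⟩ := exists_linearIndependent ℝ
    ((fun i => toReal (f i)) '' {i | u ⬝ᵥ toReal (f i) = 1})
  have hbtop : Submodule.span ℝ b = ⊤ := by rw [hbspan]; exact hut
  let B : Module.Basis b ℝ (Fin n → ℝ) := Module.Basis.mk hbli (by rw [Subtype.range_coe, hbtop])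
  let e : b ≃ Fin n := B.indexEquiv (Pi.basisFun ℝ (Fin n))
  have hex : ∀ i : Fin n, ∃ v : Fin n → ℤ, toReal v = (e.symm i : Fin n → ℝ) ∧
      u ⬝ᵥ toReal v = 1 := fun i => by
    obtain ⟨k, hk, hk'⟩ := hbs (e.symm i).2
    exact ⟨f k, hk', hk⟩
  choose g hg hgu using hex
  let A : Matrix (Fin n) (Fin n) ℤ := Matrix.of g
  have hA : (A.map (Int.castRingHom ℝ)).det ≠ 0 := by
    have hli : LinearIndependent ℝ (A.map (Int.castRingHom ℝ)).row := by
      have : (A.map (Int.castRingHom ℝ)).row = fun i => (e.symm i : Fin n → ℝ) := by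
        ext i j
        rw [← hg i]
        rfl
      rw [this]
      exact hbli.comp _ e.symm.injective
    exact ((Matrix.isUnit_iff_isUnit_det _).1 (Matrix.linearIndependent_rows_iff_isUnit.1 hli)).ne_zero
  have hAu : (A.map (Int.castRingHom ℝ)).mulVec u = 1 := by
    ext i
    rw [Matrix.mulVec, dotProduct_comm]
    exact hgu i
  have hdet : (A.map (Int.castRingHom ℝ)).det = (A.det : ℝ) := by
    rw [← RingHom.mapMatrix_apply, ← RingHom.map_det]; simp
  have hw : toReal (A.adjugate.mulVec 1) = (A.det : ℝ) • u := by
    have h1 : (A.map (Int.castRingHom ℝ)).adjugate.mulVec ((A.map (Int.castRingHom ℝ)).mulVec u)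
        = (A.det : ℝ) • u := by
      rw [Matrix.mulVec_mulVec, Matrix.adjugate_mul, hdet, Matrix.smul_mulVec, Matrix.one_mulVec]
    rw [← h1, hAu, ← RingHom.mapMatrix_apply, ← RingHom.map_adjugate]
    ext i
    simp [toReal, Matrix.mulVec, dotProduct]
  have hdet0 : (A.det : ℝ) ≠ 0 := hdet ▸ hA
  obtain ⟨w, c, hc, hwc⟩ : ∃ w : Fin n → ℤ, ∃ c : ℝ, 0 < c ∧ toReal w = c • u := by
    rcases hdet0.lt_or_gt with h | h
    · refine ⟨-A.adjugate.mulVec 1, -A.det, by linarith, ?_⟩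
      rw [neg_smul, ← hw]
      ext; simp [toReal]
    · exact ⟨_, _, h, hw⟩
  have hw0 : w ≠ 0 := by
    rintro rfl
    rw [toReal_zero] at hwc
    exact (smul_ne_zero hc.ne' hu0) hwc.symm
  obtain ⟨w', hw', d, hd, rfl⟩ := exists_primitiveVector hw0
  have hd' : (0 : ℝ) < d := by exact_mod_cast hd
  refine ⟨w', hw', (d : ℝ)⁻¹ * c, by positivity, ?_⟩
  rw [mul_smul, ← hwc]
  ext i
  simp [toReal, hd'.ne']

end Integrality

/-! ### Integral closure of ideals and its valuative bound. -/

section IntegralClosure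

variable {R : Type*} [CommRing R]

/-- An equation with `c i ∈ I ^ i` is the degree `d` part of an integral equation for `x T` over the
Rees algebra. The translation is what gives closure under addition. -/
lemma mem_idealIntegralClosure_iff {I : Ideal R} {x : R} :
    x ∈ idealIntegralClosure I ↔ IsIntegral (reesAlgebra I) (Polynomial.monomial 1 x) := by
  have hpow : ∀ j, (Polynomial.monomial 1 x : Polynomial R) ^ j = Polynomial.monomial j (x ^ j) :=
    fun j => by rw [Polynomial.monomial_pow, one_mul]
  constructor
  · rintro ⟨d, hd, c, hc, h⟩
    let C : ℕ → reesAlgebra I := fun i =>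
      ⟨Polynomial.monomial i (c i), reesAlgebra.monomial_mem.2 (hc i)⟩
    refine ⟨Polynomial.X ^ d +
      ∑ i ∈ Finset.Icc 1 d, Polynomial.C (C i) * Polynomial.X ^ (d - i), ?_, ?_⟩
    · apply Polynomial.monic_X_pow_add
      rw [Polynomial.degree_lt_iff_coeff_zero]
      intro m hm
      rw [Polynomial.finsetSum_coeff]
      refine Finset.sum_eq_zero fun i hi => ?_
      rw [Finset.mem_Icc] at hi
      rw [Polynomial.coeff_C_mul_X_pow, if_neg (by omega)]
    · have hterm : ∀ i ∈ Finset.Icc 1 d, Polynomial.eval₂ (algebraMap (reesAlgebra I) (Polynomial R))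
          (Polynomial.monomial 1 x) (Polynomial.C (C i) * Polynomial.X ^ (d - i))
          = Polynomial.monomial d (c i * x ^ (d - i)) := by
        intro i hi
        rw [Finset.mem_Icc] at hi
        rw [Polynomial.eval₂_mul, Polynomial.eval₂_C, Polynomial.eval₂_pow, Polynomial.eval₂_X, hpow]
        change Polynomial.monomial i (c i) * _ = _
        rw [Polynomial.monomial_mul_monomial, Nat.add_sub_cancel' hi.2]
      rw [Polynomial.eval₂_add, Polynomial.eval₂_pow, Polynomial.eval₂_X, hpow,
        Polynomial.eval₂_finsetSum, Finset.sum_congr rfl hterm, ← map_sum, ← map_add, h, map_zero]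
  · rintro ⟨p, hp, h⟩
    rcases subsingleton_or_nontrivial R with hR | hR
    · exact ⟨1, one_pos, 0, fun _ => zero_mem _, Subsingleton.elim _ _⟩
    -- The definition asks for `d ≥ 1`; multiplying `p` by `X` ensures it.
    wlog hd : 0 < p.natDegree generalizing p
    · refine this _ (hp.mul Polynomial.monic_X) (by rw [Polynomial.eval₂_mul, h, zero_mul]) ?_
      rw [hp.natDegree_mul Polynomial.monic_X, Polynomial.natDegree_X]
      omega
    refine ⟨p.natDegree, hd, fun i => (p.coeff (p.natDegree - i) : Polynomial R).coeff i,
      fun i => (p.coeff (p.natDegree - i)).2 i, ?_⟩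
    rw [Polynomial.eval₂_eq_sum_range] at h
    -- Only the homogeneous part of degree `natDegree p` is kept; in it the coefficient of `x ^ (d -
    -- i)` is the degree `i` component of a Rees algebra element, hence in `I ^ i`.
    have h' := congrArg (Polynomial.coeff · p.natDegree) h
    simp only [hpow, Polynomial.finsetSum_coeff, Polynomial.coeff_zero] at h'
    rw [← Finset.sum_range_reflect, Finset.sum_range_succ'] at h'
    rw [Finset.range_eq_Ico, Finset.sum_Ico_add' (fun i => (((algebraMap (reesAlgebra I) (Polynomial R))
      (p.coeff (p.natDegree + 1 - 1 - i))) * Polynomial.monomial (p.natDegree + 1 - 1 - i)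
        (x ^ (p.natDegree + 1 - 1 - i))).coeff p.natDegree)] at h'
    rw [add_comm]
    rw [← h']
    congr 1
    · refine Finset.sum_congr ?_ fun i hi => ?_
      · ext; simp
      · rw [Finset.mem_Ico] at hi
        simp only [Nat.add_sub_cancel]
        have : p.natDegree = i + (p.natDegree - i) := by omega
        conv_rhs => rw [this]
        simp only [Nat.add_sub_cancel_left]
        rw [Polynomial.coeff_mul_monomial]
        rfl
    · simp [hp.coeff_natDegree]

/-- The integral closure of an ideal is an ideal. -/
def integralClosureIdeal (I : Ideal R) : Ideal R where
  carrier := idealIntegralClosure I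
  zero_mem' := mem_idealIntegralClosure_iff.2 (by rw [map_zero]; exact isIntegral_zero)
  add_mem' ha hb := by
    rw [mem_idealIntegralClosure_iff] at *
    rw [map_add]
    exact ha.add hb
  smul_mem' r x hx := by
    rw [mem_idealIntegralClosure_iff] at *
    rw [smul_eq_mul, ← Polynomial.C_mul_monomial]
    refine IsIntegral.mul ?_ hx
    exact isIntegral_algebraMap (R := reesAlgebra I) (x := algebraMap R (reesAlgebra I) r)

lemma mem_idealIntegralClosure_of_pow_mem {I : Ideal R} {x : R} {D : ℕ} (hD : 0 < D)
    (h : x ^ D ∈ I ^ D) : x ∈ idealIntegralClosure I := by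
  refine ⟨D, hD, fun i => if i = D then -x ^ D else 0, fun i => ?_, ?_⟩
  · dsimp only
    split_ifs with hi
    · rw [hi]; exact neg_mem h
    · exact zero_mem _
  · simp [hD.ne', Nat.one_le_iff_ne_zero, ite_mul]

lemma le_of_mem_pow (v : AddValuation R ℝ≥0∞) {I : Ideal R} {α : ℝ≥0∞}
    (h : ∀ x ∈ I, α ≤ v x) (j : ℕ) {x : R} (hx : x ∈ I ^ j) : j * α ≤ v x := by
  induction j generalizing x with
  | zero => simp
  | succ j ih =>
    rw [pow_succ] at hx
    refine Submodule.mul_induction_on hx (fun y hy z hz => ?_) (fun y z hy hz => ?_)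
    · rw [v.map_mul]
      push_cast
      rw [add_mul, one_mul]
      exact add_le_add (ih hy) (h z hz)
    · exact (le_min hy hz).trans (v.map_add y z)

/-- If `v x < α`, each term `c i * x ^ (d - i)` has value strictly above `d * v x`, the value of `x
^ d`, so the equation cannot hold. -/
lemma le_of_mem_idealIntegralClosure (v : AddValuation R ℝ≥0∞) {I : Ideal R} {α : ℝ≥0∞}
    (h : ∀ x ∈ I, α ≤ v x) {x : R} (hx : x ∈ idealIntegralClosure I) : α ≤ v x := by
  obtain ⟨d, hd, c, hc, heq⟩ := hx
  by_contra! hlt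
  have hfin : v x ≠ ⊤ := hlt.ne_top
  have hterm : ∀ i ∈ Finset.Icc 1 d, (d : ℝ≥0∞) * v x < v (c i * x ^ (d - i)) := by
    intro i hi
    rw [Finset.mem_Icc] at hi
    rw [v.map_mul, v.map_pow, nsmul_eq_mul]
    have h1 := le_of_mem_pow v h i (hc i)
    have h2 : (i : ℝ≥0∞) * v x < i * α :=
      (ENNReal.mul_lt_mul_iff_right (by simp; omega) (by simp)).2 hlt
    have h3 : (d : ℝ≥0∞) = i + (d - i : ℕ) := by rw [← Nat.cast_add]; congr 1; omega
    rw [h3, add_mul]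
    exact ENNReal.add_lt_add_right (ENNReal.mul_ne_top (by simp) hfin) (h2.trans_le h1)
  have hsum : (d : ℝ≥0∞) * v x < v (∑ i ∈ Finset.Icc 1 d, c i * x ^ (d - i)) :=
    v.map_lt_sum' (by exact (ENNReal.mul_ne_top (by simp) hfin).lt_top) hterm
  have : v (x ^ d) = v (∑ i ∈ Finset.Icc 1 d, c i * x ^ (d - i)) := by
    rw [eq_neg_of_add_eq_zero_left heq, v.map_neg]
  rw [← this, v.map_pow, nsmul_eq_mul] at hsum
  exact lt_irrefl _ hsum

end IntegralClosure

/-! ### A criterion for divisoriality. -/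

section Divisorial

variable {R : Type*} [CommRing R] [IsDomain R]

/-- `e ↦ exp (-e)`, with `⊤ ↦ 0`. -/
def expNeg (e : ℕ∞) : WithZero (Multiplicative ℤ) :=
  e.recTopCoe 0 fun m => WithZero.exp (-(m : ℤ))

lemma expNeg_top : expNeg ⊤ = 0 := rfl

lemma expNeg_coe (m : ℕ) : expNeg m = WithZero.exp (-(m : ℤ)) := rfl

lemma expNeg_add (a b : ℕ∞) : expNeg (a + b) = expNeg a * expNeg b := by
  induction a using ENat.recTopCoe with
  | top => simp [expNeg_top]
  | coe a =>
    induction b using ENat.recTopCoe with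
    | top => simp [expNeg_top]
    | coe b =>
      rw [← Nat.cast_add, expNeg_coe, expNeg_coe, expNeg_coe, ← WithZero.exp_add]
      push_cast
      congr 1
      ring

lemma expNeg_le_expNeg {a b : ℕ∞} : expNeg a ≤ expNeg b ↔ b ≤ a := by
  induction a using ENat.recTopCoe with
  | top => simp [expNeg_top]
  | coe a =>
    induction b using ENat.recTopCoe with
    | top => simp [expNeg_top, expNeg_coe]
    | coe b => rw [expNeg_coe, expNeg_coe, WithZero.exp_le_exp]; simp

/-- The extension to the fraction field of an `ℕ∞`-valued valuation with trivial support. -/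
lemma exists_valuation_fractionRing (o : AddValuation R ℕ∞) (ho : ∀ x, o x = ⊤ → x = 0) :
    ∃ w : Valuation (FractionRing R) (WithZero (Multiplicative ℤ)),
      ∀ x, w (algebraMap R _ x) = expNeg (o x) := by
  let w₀ : Valuation R (WithZero (Multiplicative ℤ)) :=
    { toFun := fun x => expNeg (o x)
      map_zero' := by simp [expNeg_top]
      map_one' := by rw [o.map_one]; exact WithZero.exp_zero
      map_mul' := fun x y => by rw [o.map_mul, expNeg_add]
      map_add_le_max' := fun x y => by
        rcases le_total (o x) (o y) with h | h
        · rw [max_eq_left (expNeg_le_expNeg.2 h), expNeg_le_expNeg]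
          simpa [h] using o.map_add x y
        · rw [max_eq_right (expNeg_le_expNeg.2 h), expNeg_le_expNeg]
          simpa [h] using o.map_add x y }
  have hS : nonZeroDivisors R ≤ w₀.supp.primeCompl := by
    intro x hx hx0
    apply nonZeroDivisors.ne_zero hx
    apply ho
    have h1 : expNeg (o x) = 0 := hx0
    rw [← expNeg_top, ] at h1
    exact top_le_iff.1 (expNeg_le_expNeg.1 h1.le)
  exact ⟨w₀.extendToLocalization hS (FractionRing R), fun x =>
    Valuation.extendToLocalization_apply_map_apply _ hS _ x⟩

/-- The center of a discrete valuation on a subring `B` of its valuation ring has height one if the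
valuation ring is the localization of `B` at the center. -/
lemma exists_center_height_eq_one {B K : Type*} [CommRing B] [IsDomain B] [Field K] (φ : B →+* K)
    (hφ : Function.Injective φ) (w : Valuation K (WithZero (Multiplicative ℤ)))
    (hwB : ∀ b, w (φ b) ≤ 1)
    (hfrac : ∀ z, w z ≤ 1 → ∃ b s, w (φ s) = 1 ∧ z = φ b / φ s)
    (hnontriv : ∃ b, b ≠ 0 ∧ w (φ b) < 1) :
    ∃ P : Ideal B, P.IsPrime ∧ P.height = 1 ∧ ∀ b, b ∈ P ↔ w (φ b) < 1 := by
  let P : Ideal B :=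
    { carrier := {b | w (φ b) < 1}
      zero_mem' := by simp
      add_mem' := fun {a b} ha hb => by
        simpa using w.map_add_lt ha hb
      smul_mem' := fun c x hx => by
        have hx' : w (φ x) < 1 := hx
        change w (φ (c * x)) < 1
        rw [map_mul, w.map_mul]
        exact (mul_le_of_le_one_left' (hwB c)).trans_lt hx' }
  have hmemP : ∀ b, b ∈ P ↔ w (φ b) < 1 := fun b => Iff.rfl
  have hPprime : P.IsPrime := by
    refine ⟨fun h => ?_, fun {a b} hab => ?_⟩
    · have := (hmemP 1).1 (h ▸ Submodule.mem_top)
      simp at this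
    · by_contra! hcon
      rw [hmemP, hmemP, not_lt, not_lt] at hcon
      rw [hmemP, map_mul, w.map_mul, le_antisymm (hwB a) hcon.1, le_antisymm (hwB b) hcon.2] at hab
      simp at hab
  refine ⟨P, hPprime, le_antisymm ?_ ?_, hmemP⟩
  · rw [← Nat.cast_one, Ideal.height_le_iff]
    intro Q hQ hlt
    have hQbot : Q = ⊥ := by
      by_contra hQ0
      obtain ⟨x, hxQ, hx0⟩ := Submodule.exists_mem_ne_zero_of_ne_bot hQ0
      obtain ⟨b, hbP, hbQ⟩ := SetLike.exists_of_lt hlt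
      have hx0' : φ x ≠ 0 := (map_ne_zero_iff φ hφ).2 hx0
      have hwx : w (φ x) ≠ 0 := w.ne_zero_iff.2 hx0'
      -- Suppose a nonzero prime `Q` is strictly inside `P`, with `x ∈ Q` and `b ∈ P \ Q`. The value
      -- group is archimedean, so some `b ^ N / x` is in the valuation ring. Clearing denominators
      -- gives `b ^ N * s ∈ Q` with `b ∉ Q` and `s ∉ P`, a contradiction.
      obtain ⟨N, hN⟩ := exists_pow_lt₀ ((hmemP b).1 hbP) (Units.mk0 _ hwx)
      obtain ⟨c, s, hs, heq⟩ := hfrac (φ b ^ N / φ x) (by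
        rw [map_div₀, w.map_pow]
        exact div_le_one_of_le₀ hN.le zero_le)
      have hs0 : φ s ≠ 0 := fun h => by simp [h] at hs
      rw [div_eq_div_iff hx0' hs0, ← map_pow, ← map_mul, ← map_mul] at heq
      have hmem : b ^ N * s ∈ Q := hφ heq ▸ Q.mul_mem_left c hxQ
      rcases hQ.mem_or_mem hmem with h | h
      · exact hbQ (hQ.mem_of_pow_mem N h)
      · exact ((hmemP s).1 (hlt.le h)).ne hs
    rw [Ideal.height_eq_zero_iff_eq_bot.2 hQbot]
    simp
  · rw [Order.one_le_iff_ne_zero, Ne, Ideal.height_eq_zero_iff_eq_bot]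
    obtain ⟨b, hb0, hb⟩ := hnontriv
    intro h
    exact hb0 ((Ideal.mem_bot).1 (h ▸ (hmemP b).2 hb))

/-- `A` need not be normal: valuation rings are integrally closed, so the integral closure of `A`
stays inside the ring of `w`, and fractions from `A` already exhaust that ring. -/
lemma isDivisorial_of_valuation (v : AddValuation R ℝ≥0∞)
    (w : Valuation (FractionRing R) (WithZero (Multiplicative ℤ)))
    (hvw : ∀ x y : R, y ≠ 0 →
      (v y ≤ v x ↔ w (algebraMap R _ x / algebraMap R _ y) ≤ 1))
    (A : Subalgebra R (FractionRing R)) (hA : A.FG) (hwA : ∀ z ∈ A, w z ≤ 1)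
    (hfrac : ∀ z, w z ≤ 1 → ∃ b ∈ A, ∃ s ∈ A, w s = 1 ∧ z = b / s)
    (hnontriv : ∃ z ∈ A, z ≠ 0 ∧ w z < 1) : IsDivisorial v := by
  have hwB : ∀ z : integralClosure A (FractionRing R), w (z : FractionRing R) ≤ 1 := by
    intro z
    have h1 : IsIntegral w.integer (z : FractionRing R) := by
      obtain ⟨p, hp, hpz⟩ := z.2
      let φ : A →+* w.integer := A.val.toRingHom.codRestrict w.integer fun a => hwA a a.2
      refine ⟨p.map φ, hp.map φ, ?_⟩
      rw [Polynomial.eval₂_map]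
      exact hpz
    exact (Valuation.integer.integers w).mem_of_integral h1
  have hAB : ∀ z ∈ A, ∃ b : integralClosure A (FractionRing R), (b : FractionRing R) = z :=
    fun z hz => ⟨⟨z, isIntegral_algebraMap (R := A) (x := ⟨z, hz⟩)⟩, rfl⟩
  have hfrac' : ∀ z, w z ≤ 1 → ∃ b s : integralClosure A (FractionRing R),
      w (s : FractionRing R) = 1 ∧ z = (b : FractionRing R) / (s : FractionRing R) := by
    intro z hz
    obtain ⟨b, hb, s, hs, hs1, rfl⟩ := hfrac z hz
    obtain ⟨b, rfl⟩ := hAB b hb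
    obtain ⟨s, rfl⟩ := hAB s hs
    exact ⟨b, s, hs1, rfl⟩
  have hnontriv' : ∃ b : integralClosure A (FractionRing R), b ≠ 0 ∧ w (b : FractionRing R) < 1 := by
    obtain ⟨z, hz, hz0, hz1⟩ := hnontriv
    obtain ⟨b, rfl⟩ := hAB z hz
    exact ⟨b, fun h => hz0 (by rw [h]; rfl), hz1⟩
  obtain ⟨P, hP, hht, hmemP⟩ := exists_center_height_eq_one (B := integralClosure A (FractionRing R))
    (algebraMap (integralClosure A (FractionRing R)) (FractionRing R)) Subtype.val_injective w
    hwB hfrac' hnontriv'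
  refine ⟨A, hA, P, hP, hht, fun x y hy => ?_⟩
  rw [hvw x y hy]
  constructor
  · intro h
    obtain ⟨b, s, hs, heq⟩ := hfrac' _ h
    exact ⟨b, s, fun hsP => ((hmemP s).1 hsP).ne hs, heq⟩
  · rintro ⟨b, s, hs, h⟩
    rw [h, map_div₀]
    rw [hmemP, not_lt] at hs
    rw [show w (s : FractionRing R) = 1 from le_antisymm (hwB s) hs, div_one]
    exact hwB b

end Divisorial

/-! ### The grading by `u` and the toric valuation. -/

namespace AffineSemigroup

variable {n : ℕ} {S : AffineSemigroup n} (k : Type*) [Field k] {u : Fin n → ℤ}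
  (hu : ∀ m : S.carrier, m ≠ 0 → 0 < u ⬝ᵥ (m : Fin n → ℤ))

/-- The grading of `S` by a functional that is positive on `S \ {0}`. -/
def weight : S.carrier →+ ℕ where
  toFun m := (u ⬝ᵥ (m : Fin n → ℤ)).toNat
  map_zero' := by simp
  map_add' a b := by
    have h : ∀ m : S.carrier, 0 ≤ u ⬝ᵥ (m : Fin n → ℤ) := fun m => by
      by_cases hm : m = 0
      · simp [hm]
      · exact (hu m hm).le
    rw [AddSubmonoid.coe_add, dotProduct_add, Int.toNat_add (h a) (h b)]

lemma weight_cast (m : S.carrier) : (weight hu m : ℤ) = u ⬝ᵥ (m : Fin n → ℤ) := by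
  refine Int.toNat_of_nonneg ?_
  by_cases hm : m = 0
  · simp [hm]
  · exact (hu m hm).le

lemma weight_eq_zero {m : S.carrier} : weight hu m = 0 ↔ m = 0 := by
  refine ⟨fun h => ?_, fun h => by rw [h, map_zero]⟩
  by_contra hm
  have h1 := weight_cast hu m
  have h2 := hu m hm
  rw [h] at h1
  simp at h1
  omega

/-- The expansion of `f ∈ k[S]` into its homogeneous components with respect to `weight`. -/
def gradedExpansion : S.ring k →ₐ[k] PowerSeries (S.ring k) :=
  AddMonoidAlgebra.lift k _ S.carrier
    { toFun := fun m => PowerSeries.monomial (weight hu m.toAdd) (S.chi k m.toAdd)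
      map_one' := by
        rw [toAdd_one, map_zero, PowerSeries.monomial_zero_eq_C_apply]
        exact map_one _
      map_mul' := fun a b => by
        rw [toAdd_mul, map_add, PowerSeries.monomial_mul_monomial]
        congr 1
        simp [chi, AddMonoidAlgebra.single_mul_single] }

lemma gradedExpansion_single (m : S.carrier) (c : k) :
    gradedExpansion k hu (AddMonoidAlgebra.single m c)
      = PowerSeries.monomial (weight hu m) (AddMonoidAlgebra.single m c) := by
  rw [gradedExpansion, AddMonoidAlgebra.lift_single]
  change c • PowerSeries.monomial (weight hu m) (S.chi k m) = _
  ext1 d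
  rw [PowerSeries.coeff_smul, PowerSeries.coeff_monomial, PowerSeries.coeff_monomial]
  split_ifs
  · simp [chi]
  · simp

lemma coeff_coeff_gradedExpansion (f : S.ring k) (d : ℕ) (m : S.carrier) :
    (PowerSeries.coeff d (gradedExpansion k hu f)).coeff m
      = if weight hu m = d then f.coeff m else 0 := by
  induction f using AddMonoidAlgebra.induction_linear with
  | zero => simp
  | add f g hf hg =>
    rw [map_add, map_add, AddMonoidAlgebra.coeff_add, Finsupp.add_apply, hf, hg,
      AddMonoidAlgebra.coeff_add, Finsupp.add_apply]
    split_ifs <;> simp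
  | single m' c =>
    rw [gradedExpansion_single, PowerSeries.coeff_monomial]
    by_cases h : m' = m
    · subst h
      by_cases hd : weight hu m' = d
      · simp [hd]
      · simp [hd, Ne.symm hd]
    · split_ifs <;> simp [h]

/-- Distinct monomials never cancel, so the lowest nonzero graded piece sits at the least weight in
the support. Since `k[S]` is a domain, orders of power series add under products, which is how
multiplicativity of the toric valuation is obtained. -/
lemma order_gradedExpansion (f : S.ring k) :
    (gradedExpansion k hu f).order = ⨅ m ∈ f.coeff.support, (weight hu m : ℕ∞) := by
  apply le_antisymm
  · refine le_iInf₂ fun m hm => PowerSeries.order_le _ fun h => ?_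
    have := coeff_coeff_gradedExpansion k hu f (weight hu m) m
    rw [h, if_pos rfl] at this
    exact (Finsupp.mem_support_iff.1 hm) (by simpa using this.symm)
  · refine PowerSeries.le_order _ _ fun d hd => ?_
    apply AddMonoidAlgebra.ext
    ext m
    rw [coeff_coeff_gradedExpansion]
    split_ifs with h
    · by_contra hne
      have hm : m ∈ f.coeff.support := Finsupp.mem_support_iff.2 (by simpa using hne)
      have := hd.trans_le (iInf₂_le m hm)
      rw [h] at this
      exact lt_irrefl _ this
    · simp

lemma gradedExpansion_injective : Function.Injective (gradedExpansion k hu) := by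
  rw [injective_iff_map_eq_zero]
  intro f hf
  apply AddMonoidAlgebra.ext
  ext m
  have := coeff_coeff_gradedExpansion k hu f (weight hu m) m
  rw [hf, if_pos rfl] at this
  simpa using this.symm

lemma fixedPoint_apply (f : S.ring k) : S.fixedPoint k f = f.coeff 0 := by
  induction f using AddMonoidAlgebra.induction_linear with
  | zero => simp
  | add f g hf hg => simp [hf, hg]
  | single m c => simp [fixedPoint_single, Finsupp.single_apply]

lemma mem_maxMonomialIdeal_iff {f : S.ring k} : f ∈ S.maxMonomialIdeal k ↔ f.coeff 0 = 0 := by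
  rw [maxMonomialIdeal_eq_ker, RingHom.mem_ker, fixedPoint_apply]

/-- Nonzero exponents have positive weight, so the constant term of the expansion is the scalar
`f.coeff 0`, nonzero off the maximal monomial ideal. Hence the expansion extends to the
localization. -/
lemma isUnit_gradedExpansion (s : (S.maxMonomialIdeal k).primeCompl) :
    IsUnit ((gradedExpansion k hu).toRingHom (s : S.ring k)) := by
  rw [PowerSeries.isUnit_iff_constantCoeff]
  have hs : (s : S.ring k).coeff 0 ≠ 0 := by
    have := s.2
    rwa [Ideal.mem_primeCompl_iff, mem_maxMonomialIdeal_iff] at this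
  have : PowerSeries.constantCoeff ((gradedExpansion k hu).toRingHom (s : S.ring k))
      = algebraMap k (S.ring k) ((s : S.ring k).coeff 0) := by
    apply AddMonoidAlgebra.ext
    ext m
    rw [← PowerSeries.coeff_zero_eq_constantCoeff_apply]
    refine (coeff_coeff_gradedExpansion k hu _ 0 m).trans ?_
    by_cases hm : m = 0
    · simp [hm]
    · have := (weight_eq_zero hu).not.2 hm
      simp [hm, this]
  rw [this]
  exact (IsUnit.mk0 _ hs).map _

/-- The extension of `gradedExpansion` to the local ring. -/
def localExpansion : S.localRing k →+* PowerSeries (S.ring k) :=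
  IsLocalization.lift (M := (S.maxMonomialIdeal k).primeCompl) (isUnit_gradedExpansion k hu)

lemma localExpansion_algebraMap (f : S.ring k) :
    localExpansion k hu (algebraMap _ _ f) = gradedExpansion k hu f :=
  IsLocalization.lift_eq _ f

lemma localExpansion_injective : Function.Injective (localExpansion k hu) := by
  rw [injective_iff_map_eq_zero]
  intro x hx
  obtain ⟨f, s, rfl⟩ := IsLocalization.exists_mk'_eq (S.maxMonomialIdeal k).primeCompl x
  have h1 : localExpansion k hu (algebraMap _ _ f) = 0 := by
    rw [← IsLocalization.mk'_spec (S.localRing k) f s, map_mul, hx, zero_mul]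
  rw [localExpansion_algebraMap, map_eq_zero_iff _ (gradedExpansion_injective k hu)] at h1
  rw [h1, IsLocalization.mk'_zero]

/-- The order of vanishing along the toric divisor of `u`. -/
def toricOrder : AddValuation (S.localRing k) ℕ∞ :=
  AddValuation.of (fun x => (localExpansion k hu x).order) (by simp) (by simp)
    (fun x y => by rw [map_add]; exact PowerSeries.min_order_le_order_add _ _)
    (fun x y => by rw [map_mul, PowerSeries.order_mul])

lemma toricOrder_algebraMap (f : S.ring k) :
    toricOrder k hu (algebraMap _ _ f) = ⨅ m ∈ f.coeff.support, (weight hu m : ℕ∞) := by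
  rw [← order_gradedExpansion, ← localExpansion_algebraMap]
  rfl

lemma toricOrder_monomial (m : S.carrier) :
    toricOrder k hu (S.monomial m) = weight hu m := by
  rw [monomial, toricOrder_algebraMap]
  simp [chi]

lemma eq_zero_of_toricOrder_eq_top {x : S.localRing k} (hx : toricOrder k hu x = ⊤) : x = 0 := by
  have : (localExpansion k hu x).order = ⊤ := hx
  rw [PowerSeries.order_eq_top, map_eq_zero_iff _ (localExpansion_injective k hu)] at this
  exact this

/-- The toric valuation of `u`. -/
def toricValuation : AddValuation (S.localRing k) ℝ≥0∞ :=
  AddValuation.of (fun x => ((toricOrder k hu x : ℕ∞) : ℝ≥0∞)) (by simp) (by simp)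
    (fun x y => by
      rw [← Monotone.map_min ENat.toENNReal_mono, ENat.toENNReal_le]
      exact (toricOrder k hu).map_add x y)
    (fun x y => by rw [AddValuation.map_mul, ENat.toENNReal_add])

lemma toricValuation_apply (x : S.localRing k) :
    toricValuation k hu x = ((toricOrder k hu x : ℕ∞) : ℝ≥0∞) := rfl

lemma weight_eq_ofReal (m : S.carrier) :
    (weight hu m : ℝ≥0∞) = ENNReal.ofReal (toReal u ⬝ᵥ toReal (m : Fin n → ℤ)) := by
  rw [toReal_dotProduct, ← weight_cast hu, Int.cast_natCast, ENNReal.ofReal_natCast]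

lemma isToricValuation_toricValuation : S.IsToricValuation u (toricValuation k hu) := by
  intro f
  rw [toricValuation_apply, toricOrder_algebraMap, ENat.toENNReal_iInf]
  refine iInf_congr fun m => ?_
  rw [ENat.toENNReal_iInf]
  refine iInf_congr fun _ => ?_
  rw [← weight_eq_ofReal hu]
  simp

lemma toricValuation_monomial (m : S.carrier) :
    toricValuation k hu (S.monomial m) = ENNReal.ofReal (toReal u ⬝ᵥ toReal (m : Fin n → ℤ)) := by
  rw [toricValuation_apply, toricOrder_monomial, ← weight_eq_ofReal hu]
  simp

lemma isCentered_toricValuation : IsCentered (toricValuation k hu) := by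
  intro x hx
  rw [toricValuation_apply, pos_iff_ne_zero, Ne, ENat.toENNReal_eq_zero]
  intro h0
  have h1 : (localExpansion k hu x).order = 0 := h0
  obtain ⟨f, s, rfl⟩ := IsLocalization.exists_mk'_eq (S.maxMonomialIdeal k).primeCompl x
  have hf : f ∈ S.maxMonomialIdeal k :=
    (IsLocalization.AtPrime.mk'_mem_maximal_iff (S.localRing k) (S.maxMonomialIdeal k) f s).1 hx
  have h2 : toricOrder k hu (algebraMap _ _ f) = 0 := by
    rw [← IsLocalization.mk'_spec (S.localRing k) f s, AddValuation.map_mul, h0, zero_add]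
    have : IsUnit (localExpansion k hu (algebraMap _ _ (s : S.ring k))) :=
      (IsLocalization.map_units (S.localRing k) s).map _
    exact PowerSeries.order_zero_of_unit this
  rw [toricOrder_algebraMap] at h2
  have h3 : (1 : ℕ∞) ≤ ⨅ m ∈ f.coeff.support, (weight hu m : ℕ∞) := by
    refine le_iInf₂ fun m hm => ?_
    have hm0 : m ≠ 0 := by
      rintro rfl
      rw [mem_maxMonomialIdeal_iff] at hf
      exact (Finsupp.mem_support_iff.1 hm) hf
    have : weight hu m ≠ 0 := fun h => hm0 ((weight_eq_zero hu).1 h)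
    exact_mod_cast Nat.one_le_iff_ne_zero.2 this
  rw [h2] at h3
  exact absurd h3 (by simp)

end AffineSemigroup

/-! ### Generators of `S` and divisoriality of toric valuations. -/

namespace AffineSemigroup

variable {n : ℕ} (S : AffineSemigroup n) (k : Type*) [Field k]

lemma exists_generators : ∃ (r : ℕ) (γ : Fin r → S.carrier),
    ∀ m : S.carrier, ∃ c : Fin r → ℕ, m = ∑ i, c i • γ i := by
  obtain ⟨G, hG⟩ := S.fg
  have hmem : ∀ g ∈ G, g ∈ S.carrier := fun g hg => by
    rw [← hG]; exact AddSubmonoid.subset_closure hg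
  let e := G.equivFin
  refine ⟨G.card, fun i => ⟨(e.symm i : Fin n → ℤ), hmem _ (e.symm i).2⟩, fun m => ?_⟩
  have hm : (m : Fin n → ℤ) ∈ AddSubmonoid.closure (G : Set (Fin n → ℤ)) := by
    rw [hG]; exact m.2
  obtain ⟨c, -, hc⟩ := AddSubmonoid.mem_closure_finset.1 hm
  refine ⟨fun i => c (e.symm i), Subtype.ext ?_⟩
  rw [← hc, ← Finset.sum_coe_sort, ← e.symm.sum_comp]
  simp

/-- A surjection from a finitely generated free commutative monoid to `S`. -/
lemma exists_surjective_hom : ∃ (r : ℕ) (φ : (Fin r → ℕ) →+ S.carrier), Function.Surjective φ := by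
  obtain ⟨r, γ, hγ⟩ := S.exists_generators
  refine ⟨r, ⟨⟨fun c => ∑ i, c i • γ i, by simp⟩, fun c d => by
    simp [add_smul, Finset.sum_add_distrib]⟩, fun m => ?_⟩
  obtain ⟨c, hc⟩ := hγ m
  exact ⟨c, hc.symm⟩

variable {S}

lemma chi_add (a b : S.carrier) : S.chi k (a + b) = S.chi k a * S.chi k b := by
  simp [chi, AddMonoidAlgebra.single_mul_single]

lemma chi_zero : S.chi k 0 = 1 := rfl

lemma chi_ne_zero (m : S.carrier) : S.chi k m ≠ 0 := by
  intro h
  have := congrArg (fun f : S.ring k => f.coeff m) h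
  simp [chi] at this

lemma monomial_add (a b : S.carrier) :
    (S.monomial (a + b) : S.localRing k) = S.monomial a * S.monomial b := by
  rw [monomial, monomial, monomial, ← map_mul, chi_add]

lemma monomial_zero : (S.monomial 0 : S.localRing k) = 1 := by
  rw [monomial, chi_zero, map_one]

lemma monomial_nsmul (a : S.carrier) (j : ℕ) :
    (S.monomial (j • a) : S.localRing k) = S.monomial a ^ j := by
  induction j with
  | zero => rw [zero_smul, pow_zero, monomial_zero]
  | succ j ih => rw [succ_nsmul, monomial_add, ih, pow_succ]

section Divisorial

variable {k} {R : Type*} [CommRing R] [Algebra (S.ring k) R]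

variable (R) in
/-- The image of `χ^m` in the fraction field of an algebra over `k[S]`. -/
def fracMonomial (m : S.carrier) : FractionRing R :=
  algebraMap R (FractionRing R) (algebraMap (S.ring k) R (S.chi k m))

variable {wt : S.carrier →+ ℕ} {o : AddValuation R ℕ∞}

lemma order_chi (ho : ∀ f : S.ring k, o (algebraMap _ R f) = ⨅ m ∈ f.coeff.support, (wt m : ℕ∞))
    (m : S.carrier) : o (algebraMap _ R (S.chi k m)) = wt m := by
  rw [ho]
  simp [chi]

variable [IsDomain R]

/-- Adjoin all quotients of monomials of nonnegative weight. A slack variable turns `wt b ≤ wt a`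
into an equation between two homomorphisms out of a free commutative monoid of finite rank, whose
solution monoid is finitely generated; finitely many quotients therefore suffice. -/
lemma exists_fg_subalgebra
    (ho : ∀ f : S.ring k, o (algebraMap _ R f) = ⨅ m ∈ f.coeff.support, (wt m : ℕ∞))
    (w : Valuation (FractionRing R) (WithZero (Multiplicative ℤ)))
    (hw : ∀ x, w (algebraMap R _ x) = expNeg (o x)) :
    ∃ A : Subalgebra R (FractionRing R), A.FG ∧
      (∀ a b : S.carrier, wt b ≤ wt a →
        fracMonomial (k := k) R a / fracMonomial (k := k) R b ∈ A) ∧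
      ∀ z ∈ A, w z ≤ 1 := by
  classical
  obtain ⟨r, φ, hφ⟩ := S.exists_surjective_hom
  let f : (Fin r → ℕ) × (Fin r → ℕ) × ℕ →+ ℕ :=
    (wt.comp φ).comp (AddMonoidHom.fst _ _)
  let g : (Fin r → ℕ) × (Fin r → ℕ) × ℕ →+ ℕ :=
    ((wt.comp φ).coprod (AddMonoidHom.id ℕ)).comp (AddMonoidHom.snd _ _)
  obtain ⟨T, hT⟩ := AddSubmonoid.fg_eqLocusM f g
  have hmemT : ∀ t, t ∈ AddSubmonoid.closure (T : Set ((Fin r → ℕ) × (Fin r → ℕ) × ℕ)) ↔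
      wt (φ t.1) = wt (φ t.2.1) + t.2.2 := fun t => by rw [hT]; rfl
  let q : (Fin r → ℕ) × (Fin r → ℕ) × ℕ → FractionRing R := fun t =>
    fracMonomial (k := k) R (φ t.1) / fracMonomial (k := k) R (φ t.2.1)
  have hq0 : q 0 = 1 := by simp [q, fracMonomial, chi_zero]
  have hqadd : ∀ s t, q (s + t) = q s * q t := fun s t => by
    simp only [q, fracMonomial, Prod.fst_add, Prod.snd_add, map_add, chi_add, map_mul]
    rw [mul_div_mul_comm]
  have hwq : ∀ t ∈ T, w (q t) ≤ 1 := by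
    intro t ht
    have h1 := (hmemT t).1 (AddSubmonoid.subset_closure ht)
    rw [map_div₀]
    refine div_le_one_of_le₀ ?_ zero_le
    rw [fracMonomial, fracMonomial, hw, hw, expNeg_le_expNeg, order_chi ho, order_chi ho]
    exact_mod_cast (by omega : wt (φ t.2.1) ≤ wt (φ t.1))
  have hwR : ∀ x, w (algebraMap R _ x) ≤ 1 := fun x => by
    rw [hw, ← show expNeg 0 = 1 from WithZero.exp_zero, expNeg_le_expNeg]
    exact zero_le
  obtain ⟨A, hA⟩ : ∃ A : Subalgebra R (FractionRing R), A = Algebra.adjoin R (q '' T) := ⟨_, rfl⟩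
  have hqT : ∀ t ∈ T, q t ∈ A := fun t ht => by
    rw [hA]
    exact Algebra.subset_adjoin ⟨t, ht, rfl⟩
  refine ⟨A, Subalgebra.fg_def.2 ⟨q '' T, T.finite_toSet.image q, hA.symm⟩, ?_, fun z hz => ?_⟩
  · have hqA : ∀ t ∈ AddSubmonoid.closure (T : Set ((Fin r → ℕ) × (Fin r → ℕ) × ℕ)), q t ∈ A := by
      intro t ht
      induction ht using AddSubmonoid.closure_induction with
      | mem t ht => exact hqT t ht
      | zero => exact hq0 ▸ A.one_mem
      | add s t _ _ hs ht => exact hqadd s t ▸ A.mul_mem hs ht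
    intro a b hab
    obtain ⟨c, rfl⟩ := hφ a
    obtain ⟨d, rfl⟩ := hφ b
    refine hqA (c, d, wt (φ c) - wt (φ d)) ((hmemT _).2 ?_)
    dsimp only
    omega
  · rw [hA] at hz
    induction hz using Algebra.adjoin_induction with
    | mem z hz =>
      obtain ⟨t, ht, rfl⟩ := hz
      exact hwq t ht
    | algebraMap x => exact hwR x
    | add y z _ _ hy hz => exact (w.map_add y z).trans (max_le hy hz)
    | mul y z _ _ hy hz => rw [w.map_mul]; exact mul_le_one' hy hz

lemma div_fracMonomial_mem
    (ho : ∀ f : S.ring k, o (algebraMap _ R f) = ⨅ m ∈ f.coeff.support, (wt m : ℕ∞))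
    {A : Subalgebra R (FractionRing R)}
    (hA : ∀ a b : S.carrier, wt b ≤ wt a →
      fracMonomial (k := k) R a / fracMonomial (k := k) R b ∈ A)
    (f : S.ring k) (m : S.carrier) (hf : (wt m : ℕ∞) ≤ o (algebraMap _ R f)) :
    algebraMap R (FractionRing R) (algebraMap _ _ f) / fracMonomial (k := k) R m ∈ A := by
  rw [ho] at hf
  have hf' : ∀ a ∈ f.coeff.support, wt m ≤ wt a := fun a ha => by
    exact_mod_cast hf.trans (iInf₂_le a ha)
  have hsum : f = ∑ a ∈ f.coeff.support, AddMonoidAlgebra.single 0 (f.coeff a) * S.chi k a := by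
    conv_lhs => rw [← AddMonoidAlgebra.sum_coeff_single f]
    refine Finset.sum_congr rfl fun a _ => ?_
    simp [chi, AddMonoidAlgebra.single_mul_single]
  rw [hsum, map_sum, map_sum, Finset.sum_div]
  refine sum_mem fun a ha => ?_
  rw [map_mul, map_mul, mul_div_assoc]
  exact mul_mem (A.algebraMap_mem _) (hA a m (hf' a ha))

/-- Write an element of the valuation ring as `F / G` with `F`, `G` in `k[S]`, and take `χ^m` of
least weight in `G`. Then `F / χ^m` and `G / χ^m` both lie in `A`, and the latter has value one
under `w`. -/
lemma isDivisorial_of_order (hinj : Function.Injective (algebraMap (S.ring k) R))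
    (hfrac : ∀ x : R, ∃ f g : S.ring k, g ≠ 0 ∧ x * algebraMap _ R g = algebraMap _ R f)
    (ho : ∀ f : S.ring k, o (algebraMap _ R f) = ⨅ m ∈ f.coeff.support, (wt m : ℕ∞))
    (ho0 : ∀ x, o x = ⊤ → x = 0) (hwt : ∃ m, wt m ≠ 0)
    (v : AddValuation R ℝ≥0∞) (hv : ∀ x, v x = ((o x : ℕ∞) : ℝ≥0∞)) :
    IsDivisorial v := by
  obtain ⟨w, hw⟩ := exists_valuation_fractionRing o ho0
  obtain ⟨A, hA, hmon, hwA⟩ := exists_fg_subalgebra ho w hw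
  have hinjK := IsFractionRing.injective R (FractionRing R)
  have hdiv : ∀ x y : R, y ≠ 0 → (o y ≤ o x ↔
      w (algebraMap _ _ x / algebraMap _ _ y) ≤ 1) := by
    intro x y hy
    have hy' : w (algebraMap _ (FractionRing R) y) ≠ 0 :=
      w.ne_zero_iff.2 ((map_ne_zero_iff _ hinjK).2 hy)
    rw [map_div₀, div_le_one₀ (zero_lt_iff.2 hy'), hw, hw, expNeg_le_expNeg]
  have hchi0 : ∀ m, fracMonomial (k := k) R m ≠ 0 := fun m =>
    (map_ne_zero_iff _ hinjK).2 ((map_ne_zero_iff _ hinj).2 (chi_ne_zero k m))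
  refine isDivisorial_of_valuation v w (fun x y hy => ?_) A hA hwA (fun z hz => ?_) ?_
  · rw [hv, hv, ENat.toENNReal_le, hdiv x y hy]
  · obtain ⟨F, G, hG0, rfl⟩ : ∃ F G : S.ring k, G ≠ 0 ∧
        z = algebraMap R _ (algebraMap _ R F) / algebraMap R _ (algebraMap _ R G) := by
      obtain ⟨x, y, hy, rfl⟩ := IsFractionRing.div_surjective (A := R) z
      have hy0 : y ≠ 0 := nonZeroDivisors.ne_zero hy
      obtain ⟨f, s, hs, hfs⟩ := hfrac x
      obtain ⟨g, t, ht, hgt⟩ := hfrac y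
      have hs' := (map_ne_zero_iff _ hinj).2 hs
      have ht' := (map_ne_zero_iff _ hinj).2 ht
      have hg' : algebraMap _ R g ≠ 0 := hgt ▸ mul_ne_zero hy0 ht'
      refine ⟨f * t, g * s, fun h => ?_, ?_⟩
      · have := congrArg (algebraMap _ R) h
        rw [map_mul, map_zero] at this
        exact mul_ne_zero hg' hs' this
      · rw [div_eq_div_iff ((map_ne_zero_iff _ hinjK).2 hy0), ← map_mul, ← map_mul]
        · congr 1
          rw [map_mul, map_mul, ← hfs, ← hgt]
          ring
        · rw [map_mul]
          exact (map_ne_zero_iff _ hinjK).2 (mul_ne_zero hg' hs')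
    rw [← hdiv _ _ ((map_ne_zero_iff _ hinj).2 hG0)] at hz
    obtain ⟨m, hm⟩ : ∃ m : S.carrier, o (algebraMap _ _ G) = wt m := by
      have hne : G.coeff.support.Nonempty := by
        rw [Finsupp.support_nonempty_iff]
        exact fun h => hG0 (AddMonoidAlgebra.ext h)
      obtain ⟨m, hm, hmin⟩ := G.coeff.support.exists_min_image wt hne
      refine ⟨m, ?_⟩
      rw [ho]
      exact le_antisymm (iInf₂_le m hm) (le_iInf₂ fun a ha => by exact_mod_cast hmin a ha)
    refine ⟨_, div_fracMonomial_mem ho hmon F m (hm ▸ hz), _,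
      div_fracMonomial_mem ho hmon G m hm.ge, ?_, ?_⟩
    · rw [map_div₀, fracMonomial, hw, hw, hm, order_chi ho]
      refine div_self ?_
      rw [expNeg_coe]
      exact WithZero.exp_ne_zero
    · rw [div_div_div_cancel_right₀ (hchi0 m)]
  · obtain ⟨m, hm⟩ := hwt
    refine ⟨fracMonomial (k := k) R m, A.algebraMap_mem _, hchi0 m, ?_⟩
    rw [fracMonomial, hw, order_chi ho, ← show expNeg 0 = 1 from WithZero.exp_zero, ← not_le,
      expNeg_le_expNeg, not_le, pos_iff_ne_zero]
    exact_mod_cast hm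

end Divisorial

lemma isDivisorial_toricValuation {u : Fin n → ℤ}
    (hu : ∀ m : S.carrier, m ≠ 0 → 0 < u ⬝ᵥ (m : Fin n → ℤ)) (hS : ∃ m : S.carrier, m ≠ 0) :
    IsDivisorial (toricValuation k hu) := by
  refine isDivisorial_of_order (k := k) (wt := weight hu) (o := toricOrder k hu) ?_ ?_
    (toricOrder_algebraMap k hu) (fun x hx => eq_zero_of_toricOrder_eq_top k hu hx)
    (hS.imp fun m hm => (weight_eq_zero hu).not.2 hm) _ (toricValuation_apply k hu)
  · exact IsLocalization.injective _ (Ideal.primeCompl_le_nonZeroDivisors (S.maxMonomialIdeal k))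
  · intro x
    obtain ⟨f, s, rfl⟩ := IsLocalization.exists_mk'_eq (S.maxMonomialIdeal k).primeCompl x
    exact ⟨f, s, fun h => s.2 (by rw [h]; exact zero_mem _), IsLocalization.mk'_spec _ f s⟩

end AffineSemigroup

/-! ### Newton polyhedra and the normals of their compact facets. -/

section

variable {n : ℕ} {ι : Type*} [Fintype ι]

lemma convex_upperHull (f : ι → Fin n → ℝ) : Convex ℝ (upperHull f) := by
  rintro x ⟨c, hc, hc1, rfl⟩ y ⟨d, hd, hd1, rfl⟩ s t hs ht hst
  refine ⟨fun i => s * c i + t * d i,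
    fun i => add_nonneg (mul_nonneg hs (hc i)) (mul_nonneg ht (hd i)), ?_, ?_⟩
  · rw [Finset.sum_add_distrib, ← Finset.mul_sum, ← Finset.mul_sum]
    nlinarith
  · simp_rw [add_smul, mul_smul]
    rw [Finset.sum_add_distrib, Finset.smul_sum, Finset.smul_sum]

lemma add_mem_upperHull {f : ι → Fin n → ℝ} {x : Fin n → ℝ} (hx : x ∈ upperHull f) {d : ι → ℝ}
    (hd : ∀ i, 0 ≤ d i) : x + ∑ i, d i • f i ∈ upperHull f := by
  obtain ⟨c, hc, hc1, rfl⟩ := hx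
  refine ⟨fun i => c i + d i, fun i => add_nonneg (hc i) (hd i), ?_, ?_⟩
  · rw [Finset.sum_add_distrib]
    linarith [Finset.sum_nonneg fun i (_ : i ∈ Finset.univ) => hd i]
  · simp_rw [add_smul]
    rw [Finset.sum_add_distrib]

lemma face_smul (C : Set (Fin n → ℝ)) {c : ℝ} (hc : 0 < c) (u : Fin n → ℝ) :
    face C (c • u) = face C u := by
  ext x
  simp only [face, Set.mem_ofPred_eq, smul_dotProduct, smul_eq_mul, mul_le_mul_iff_right₀ hc]

end

namespace AffineSemigroup

variable {n : ℕ} {S : AffineSemigroup n} {k : Type*} [Field k]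

/-- A finite family of exponents of an ideal that generates both its Newton polyhedron and the
cone of the semigroup. -/
structure NewtonGenerators (a : Ideal (S.localRing k)) {ι : Type*} [Fintype ι]
    (f : ι → S.carrier) : Prop where
  monomial_mem : ∀ i, S.monomial (f i) ∈ a
  ne_zero : ∀ i, f i ≠ 0
  exists_add : ∀ m : S.carrier, S.monomial m ∈ a → ∃ i, ∃ s : S.carrier, m = f i + s
  exists_cone : ∀ x ∈ S.cone, ∃ c : ι → ℝ, (∀ i, 0 ≤ c i) ∧
    x = ∑ i, c i • toReal (f i : Fin n → ℤ)

lemma toReal_mem_cone (m : S.carrier) : toReal (m : Fin n → ℤ) ∈ S.cone :=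
  Submodule.subset_span ⟨_, m.2, rfl⟩

lemma toReal_coe_ne_zero {m : S.carrier} (hm : m ≠ 0) : toReal (m : Fin n → ℤ) ≠ 0 := fun h =>
  hm (Subtype.ext (toReal_injective (h.trans toReal_zero.symm)))

/-- The radical hypothesis gives an `N` with `χ^(N γ j) ∈ a` for every nonzero generator `γ j`.
Exponents of `a` whose coefficients are all at most `N` then suffice: a larger coefficient lets `N •
γ j` be split off, and the `N • γ j` generate the cone. -/
lemma exists_newtonGenerators (a : Ideal (S.localRing k))
    (ha : a.radical = IsLocalRing.maximalIdeal (S.localRing k)) :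
    ∃ (ι : Type) (_ : Fintype ι) (f : ι → S.carrier), NewtonGenerators a f := by
  classical
  obtain ⟨r, γ, hγ⟩ := S.exists_generators
  have hatop : a ≠ ⊤ := by
    rintro rfl
    rw [Ideal.radical_top] at ha
    exact (IsLocalRing.maximalIdeal.isMaximal (S.localRing k)).ne_top ha.symm
  have hpow : ∀ j, ∃ N : ℕ, γ j ≠ 0 → (S.monomial (γ j) : S.localRing k) ^ N ∈ a := by
    intro j
    by_cases hj : γ j = 0
    · exact ⟨0, fun h => absurd hj h⟩
    have : (S.monomial (γ j) : S.localRing k) ∈ a.radical := by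
      rw [ha, ← IsLocalization.AtPrime.map_eq_maximalIdeal (S.maxMonomialIdeal k) (S.localRing k)]
      exact Ideal.mem_map_of_mem _ (Ideal.subset_span ⟨γ j, hj, rfl⟩)
    obtain ⟨N, hN⟩ := this
    exact ⟨N, fun _ => hN⟩
  choose M hM using hpow
  -- The sum dominates every `M j`; the `+ 1` keeps `N` nonzero, since cone coefficients are later
  -- divided by it.
  set N := ∑ j, M j + 1 with hN
  have hNmem : ∀ j, γ j ≠ 0 → S.monomial (N • γ j) ∈ a := by
    intro j hj
    rw [monomial_nsmul]
    refine a.pow_mem_of_pow_mem (hM j hj) ?_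
    have := Finset.single_le_sum (f := M) (fun _ _ => Nat.zero_le _) (Finset.mem_univ j)
    omega
  let ι := {x : Fin r → Fin (N + 1) // S.monomial (∑ j, (x j : ℕ) • γ j) ∈ a}
  have hsurj : ∀ c : Fin r → ℕ, (∀ j, c j ≤ N) → S.monomial (∑ j, c j • γ j) ∈ a →
      ∃ i : ι, ∑ j, (i.1 j : ℕ) • γ j = ∑ j, c j • γ j := fun c hc hmem =>
    ⟨⟨fun j => ⟨c j, Nat.lt_succ_of_le (hc j)⟩, hmem⟩, rfl⟩
  have hsurjN : ∀ j, γ j ≠ 0 → ∃ i : ι, ∑ j, (i.1 j : ℕ) • γ j = N • γ j := by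
    intro j hj
    have h1 : ∑ l, (Pi.single j N : Fin r → ℕ) l • γ l = N • γ j := by
      rw [Finset.sum_eq_single j]
      · simp
      · intro l _ hl; simp [hl]
      · simp
    obtain ⟨i, hi⟩ := hsurj (Pi.single j N) (fun l => by by_cases h : l = j <;> simp [h])
      (by rw [h1]; exact hNmem j hj)
    exact ⟨i, hi.trans h1⟩
  refine ⟨ι, inferInstance, fun i => ∑ j, (i.1 j : ℕ) • γ j, fun i => i.2, fun i hi => ?_,
    fun m hm => ?_, fun x hx => ?_⟩
  · have := i.2
    rw [hi, monomial_zero] at this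
    exact hatop ((Ideal.eq_top_iff_one a).2 this)
  · obtain ⟨c, rfl⟩ := hγ m
    by_cases hbig : ∃ j, γ j ≠ 0 ∧ N < c j
    · obtain ⟨j, hj, hlt⟩ := hbig
      obtain ⟨i, hi⟩ := hsurjN j hj
      refine ⟨i, (c j - N) • γ j + ∑ l ∈ Finset.univ.erase j, c l • γ l, ?_⟩
      rw [hi, ← add_assoc, ← add_smul, Nat.add_sub_cancel' hlt.le,
        Finset.add_sum_erase _ (fun l => c l • γ l) (Finset.mem_univ j)]
    · push Not at hbig
      -- A generator may be zero, and its coefficient is then not bounded by `N`; it is reset to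
      -- zero.
      have h1 : ∑ j, c j • γ j = ∑ j, (if γ j = 0 then 0 else c j) • γ j := by
        refine Finset.sum_congr rfl fun j _ => ?_
        split_ifs with h
        · rw [h, smul_zero, smul_zero]
        · rfl
      rw [h1] at hm ⊢
      obtain ⟨i, hi⟩ := hsurj _ (fun j => by
        split_ifs with h
        exacts [Nat.zero_le _, hbig j h]) hm
      exact ⟨i, 0, by rw [hi, add_zero]⟩
  · have hcone : S.cone ≤ PointedCone.hull ℝ (Set.range fun i : ι =>
        toReal ((∑ j, (i.1 j : ℕ) • γ j : S.carrier) : Fin n → ℤ)) := by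
      rw [cone, PointedCone.hull, Submodule.span_le]
      rintro _ ⟨m, hm, rfl⟩
      obtain ⟨c, hc⟩ := hγ ⟨m, hm⟩
      have hmc : toReal m = ∑ j, (c j : ℝ) • toReal (γ j : Fin n → ℤ) := by
        have : m = ∑ j, c j • (γ j : Fin n → ℤ) := by
          have := congrArg Subtype.val hc
          simpa using this
        rw [this]
        ext l
        simp [toReal, Finset.sum_apply]
      rw [hmc]
      refine Submodule.sum_mem _ fun j _ => ?_
      by_cases hj : γ j = 0
      · rw [hj, AddSubmonoid.coe_zero, toReal_zero, smul_zero]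
        exact Submodule.zero_mem _
      obtain ⟨i, hi⟩ := hsurjN j hj
      have hN0 : (N : ℝ) ≠ 0 := by rw [hN]; positivity
      have h2 : (c j : ℝ) • toReal (γ j : Fin n → ℤ)
          = (⟨c j / N, by positivity⟩ : {c : ℝ // 0 ≤ c}) •
            toReal ((∑ j, (i.1 j : ℕ) • γ j : S.carrier) : Fin n → ℤ) := by
        change _ = (c j / N : ℝ) • toReal ((∑ j, (i.1 j : ℕ) • γ j : S.carrier) : Fin n → ℤ)
        rw [hi, AddSubmonoidClass.coe_nsmul, toReal_nsmul, smul_smul, div_mul_cancel₀ _ hN0]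
      rw [h2]
      exact Submodule.smul_mem _ _ (Submodule.subset_span ⟨i, rfl⟩)
    obtain ⟨c, hc⟩ := (Submodule.mem_span_range_iff_exists_fun _).1 (hcone hx)
    exact ⟨fun i => c i, fun i => (c i).2, hc.symm⟩

section

variable {a : Ideal (S.localRing k)} {ι : Type*} [Fintype ι] {f : ι → S.carrier}

/-- The set `upperHull` is convex, contains the exponents and absorbs the cone. Conversely, when `s
= ∑ c i ≥ 1`, split `x = s⁻¹ x + (1 - s⁻¹) x` into a convex combination and a cone element. -/
lemma NewtonGenerators.newtonPolyhedron_eq (hf : NewtonGenerators a f) :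
    newtonPolyhedron a = upperHull fun i => toReal (f i : Fin n → ℤ) := by
  apply Set.Subset.antisymm
  · rintro _ ⟨y, hy, z, hz, rfl⟩
    obtain ⟨c, hc, rfl⟩ := hf.exists_cone z hz
    refine add_mem_upperHull (convexHull_min ?_ (convex_upperHull _) hy) hc
    rintro _ ⟨m, ⟨hmS, hm⟩, rfl⟩
    obtain ⟨i, s, hi⟩ := hf.exists_add ⟨m, hmS⟩ hm
    have : toReal m = toReal (f i : Fin n → ℤ) + toReal (s : Fin n → ℤ) := by
      rw [← toReal_add]
      exact congrArg toReal (congrArg Subtype.val hi)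
    obtain ⟨c, hc, hs⟩ := hf.exists_cone _ (toReal_mem_cone s)
    rw [this, hs]
    exact add_mem_upperHull (mem_upperHull_self _ i) hc
  · rintro x ⟨c, hc, hc1, rfl⟩
    set s := ∑ i, c i with hs
    have hs0 : 0 < s := by linarith
    refine ⟨∑ i, (s⁻¹ * c i) • toReal (f i : Fin n → ℤ), ?_,
      ∑ i, ((1 - s⁻¹) * c i) • toReal (f i : Fin n → ℤ), ?_, ?_⟩
    · refine (convex_convexHull ℝ _).sum_mem (fun i _ => by have := hc i; positivity) ?_
        fun i _ => subset_convexHull ℝ _ ⟨_, ⟨(f i).2, hf.monomial_mem i⟩, rfl⟩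
      rw [← Finset.mul_sum, ← hs, inv_mul_cancel₀ hs0.ne']
    · refine Submodule.sum_mem _ fun i _ => ?_
      exact Submodule.smul_mem S.cone
        (⟨(1 - s⁻¹) * c i, mul_nonneg (sub_nonneg.2 (inv_le_one_of_one_le₀ hc1)) (hc i)⟩ :
          {c : ℝ // 0 ≤ c}) (toReal_mem_cone (f i))
    · dsimp only
      rw [← Finset.sum_add_distrib]
      refine Finset.sum_congr rfl fun i _ => ?_
      rw [← add_smul]
      congr 1
      ring

lemma NewtonGenerators.span_eq_top (hf : NewtonGenerators a f) :
    Submodule.span ℝ (Set.range fun i => toReal (f i : Fin n → ℤ)) = ⊤ := by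
  rw [eq_top_iff, ← S.full_dim, Submodule.span_le]
  rintro _ ⟨m, hm, rfl⟩
  obtain ⟨c, -, hc⟩ := hf.exists_cone _ (toReal_mem_cone ⟨m, hm⟩)
  have hc' : toReal m = _ := hc
  rw [hc']
  exact Submodule.sum_mem _ fun i _ => Submodule.smul_mem _ _ (Submodule.subset_span ⟨i, rfl⟩)

/-- A convex relation with `c i > 0` would put `-f i` in the cone, against pointedness. -/
lemma NewtonGenerators.zero_notMem (hf : NewtonGenerators a f) :
    (0 : Fin n → ℝ) ∉ convexHull ℝ (Set.range fun i => toReal (f i : Fin n → ℤ)) := by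
  classical
  rw [mem_convexHull_range_iff]
  rintro ⟨c, hc, hc1, hsum⟩
  obtain ⟨i, -, hi⟩ : ∃ i ∈ Finset.univ, c i ≠ 0 := by
    by_contra! h
    rw [Finset.sum_eq_zero h] at hc1
    exact zero_ne_one hc1
  have hi' : 0 < c i := lt_of_le_of_ne (hc i) hi.symm
  refine toReal_coe_ne_zero (hf.ne_zero i) (S.pointed _ (toReal_mem_cone (f i)) ?_)
  have : -toReal (f i : Fin n → ℤ)
      = ∑ j ∈ Finset.univ.erase i, ((c i)⁻¹ * c j) • toReal (f j : Fin n → ℤ) := by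
    simp_rw [mul_smul]
    rw [← Finset.smul_sum]
    have h1 := Finset.add_sum_erase Finset.univ (fun j => c j • toReal (f j : Fin n → ℤ))
      (Finset.mem_univ i)
    rw [← hsum] at h1
    rw [eq_neg_of_add_eq_zero_right h1, smul_neg, smul_smul, inv_mul_cancel₀ hi, one_smul]
  rw [this]
  refine Submodule.sum_mem _ fun j _ => ?_
  exact Submodule.smul_mem S.cone
    (⟨(c i)⁻¹ * c j, mul_nonneg (inv_nonneg.2 (hc i)) (hc j)⟩ : {c : ℝ // 0 ≤ c})
    (toReal_mem_cone (f j))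

lemma mem_dualCone_of_blocker (hf : NewtonGenerators a f) {v : Fin n → ℝ}
    (hv : ∀ i, 0 ≤ v ⬝ᵥ toReal (f i : Fin n → ℤ)) : v ∈ S.dualCone := by
  intro x hx
  obtain ⟨c, hc, rfl⟩ := hf.exists_cone x hx
  rw [dotProduct_sum_smul]
  exact Finset.sum_nonneg fun i _ => mul_nonneg (hc i) (hv i)

/-- Positive multiples of the vertices of the blocker are normals of compact facets. -/
lemma NewtonGenerators.mem_facetNormals (hn : 1 ≤ n) (hf : NewtonGenerators a f) {v : Fin n → ℝ}
    (hv : v ∈ blocker fun i => toReal (f i : Fin n → ℤ))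
    (hvt : tightSpan (fun i => toReal (f i : Fin n → ℤ)) v = ⊤) {u : Fin n → ℤ}
    (hu : IsPrimitiveVector u) {c : ℝ} (hc : 0 < c) (huv : toReal u = c • v) :
    u ∈ facetNormals a := by
  have hne := tight_nonempty hn hvt
  have hface : face (newtonPolyhedron a) (toReal u) = convexHull ℝ
      ((fun i => toReal (f i : Fin n → ℤ)) '' {i | v ⬝ᵥ toReal (f i : Fin n → ℤ) = 1}) := by
    rw [huv, face_smul _ hc, hf.newtonPolyhedron_eq, face_upperHull hv hne]
  refine ⟨hu, ?_, face (newtonPolyhedron a) (toReal u), ⟨?_, ⟨_, rfl⟩, ?_⟩, ?_, rfl⟩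
  · refine mem_dualCone_of_blocker hf fun i => ?_
    rw [huv, smul_dotProduct]
    exact mul_nonneg hc.le (zero_le_one.trans (hv i))
  · rw [hface, convexHull_nonempty_iff]
    exact Set.Nonempty.image _ hne
  · rw [hface]
    refine (finrank_vectorSpan_convexHull (u := v) ?_ (Set.Nonempty.image _ hne)).2 hvt
    rintro _ ⟨i, hi, rfl⟩
    exact hi
  · rw [hface]
    exact ((Set.toFinite {i | v ⬝ᵥ toReal (f i : Fin n → ℤ) = 1}).image _).isCompact_convexHull
      (𝕜 := ℝ)

/-- Compactness enters here: if `u` vanished on `f i`, the face would contain a ray in direction `f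
i` and be unbounded. -/
lemma NewtonGenerators.dotProduct_pos (hf : NewtonGenerators a f) {u : Fin n → ℤ}
    (hu : u ∈ facetNormals a) (i : ι) : 0 < toReal u ⬝ᵥ toReal (f i : Fin n → ℤ) := by
  obtain ⟨-, hdual, F, ⟨⟨x, hx⟩, -, -⟩, hcomp, rfl⟩ := hu
  refine lt_of_le_of_ne (hdual _ (toReal_mem_cone (f i))) fun h0 => ?_
  have hmem : ∀ t : ℝ, 0 ≤ t →
      x + t • toReal (f i : Fin n → ℤ) ∈ face (newtonPolyhedron a) (toReal u) := by
    classical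
    intro t ht
    refine ⟨?_, fun y hy => ?_⟩
    · have hx1 := hx.1
      rw [hf.newtonPolyhedron_eq] at hx1 ⊢
      have := add_mem_upperHull hx1 (d := Pi.single i t)
        (fun j => by by_cases h : j = i <;> simp [h, ht])
      simpa [Pi.single_apply, ite_smul] using this
    · rw [dotProduct_add, dotProduct_smul, ← h0, smul_zero, add_zero]
      exact hx.2 y hy
  obtain ⟨B, hB⟩ := hcomp.isBounded.exists_norm_le
  have hpos : 0 < ‖toReal (f i : Fin n → ℤ)‖ := norm_pos_iff.2 (toReal_coe_ne_zero (hf.ne_zero i))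
  have hBx := hB x hx
  have hB0 : 0 ≤ B := (norm_nonneg _).trans hBx
  set t := (B + ‖x‖ + 1) / ‖toReal (f i : Fin n → ℤ)‖ with htdef
  have ht : 0 ≤ t := by positivity
  have h1 := hB _ (hmem t ht)
  have h2 : ‖t • toReal (f i : Fin n → ℤ)‖ ≤ ‖x + t • toReal (f i : Fin n → ℤ)‖ + ‖x‖ := by
    have := norm_sub_le (x + t • toReal (f i : Fin n → ℤ)) x
    simpa using this
  rw [norm_smul, Real.norm_of_nonneg ht, htdef, div_mul_cancel₀ _ hpos.ne'] at h2
  rw [htdef] at h1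
  linarith

lemma NewtonGenerators.dotProduct_pos_of_ne_zero (hf : NewtonGenerators a f) {u : Fin n → ℤ}
    (hu : u ∈ facetNormals a) (m : S.carrier) (hm : m ≠ 0) : 0 < u ⬝ᵥ (m : Fin n → ℤ) := by
  obtain ⟨c, hc, hmc⟩ := hf.exists_cone _ (toReal_mem_cone m)
  have hpos : 0 < toReal u ⬝ᵥ toReal (m : Fin n → ℤ) := by
    rw [hmc, dotProduct_sum_smul]
    have hnn : ∀ i ∈ Finset.univ, 0 ≤ c i * (toReal u ⬝ᵥ toReal (f i : Fin n → ℤ)) :=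
      fun i _ => mul_nonneg (hc i) (hf.dotProduct_pos hu i).le
    refine lt_of_le_of_ne (Finset.sum_nonneg hnn) fun h => toReal_coe_ne_zero hm ?_
    rw [hmc]
    refine Finset.sum_eq_zero fun i hi => ?_
    have := (Finset.sum_eq_zero_iff_of_nonneg hnn).1 h.symm i hi
    rw [(mul_eq_zero.1 this).resolve_right (hf.dotProduct_pos hu i).ne', zero_smul]
  rw [toReal_dotProduct] at hpos
  exact_mod_cast hpos

/-- Normals of compact facets are positive multiples of vertices of the blocker. -/
lemma NewtonGenerators.exists_vertex_of_mem_facetNormals (hf : NewtonGenerators a f)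
    {u : Fin n → ℤ} (hu : u ∈ facetNormals a) :
    ∃ v ∈ blocker fun i => toReal (f i : Fin n → ℤ),
      tightSpan (fun i => toReal (f i : Fin n → ℤ)) v = ⊤ ∧ ∃ c : ℝ, 0 < c ∧ toReal u = c • v := by
  have hpos := hf.dotProduct_pos hu
  obtain ⟨-, -, F, ⟨⟨x, hx⟩, -, hdim⟩, -, rfl⟩ := hu
  have hne : Nonempty ι := by
    have hx1 := hx.1
    rw [hf.newtonPolyhedron_eq] at hx1
    obtain ⟨c, -, hc1, -⟩ := hx1
    by_contra h
    rw [not_nonempty_iff] at h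
    norm_num at hc1
  -- Dividing `u` by its least value `h` on the exponents, which is positive, makes it a point of
  -- the blocker with a tight constraint.
  obtain ⟨i₀, -, hmin⟩ := Finset.univ.exists_min_image
    (fun i => toReal u ⬝ᵥ toReal (f i : Fin n → ℤ)) Finset.univ_nonempty
  set h := toReal u ⬝ᵥ toReal (f i₀ : Fin n → ℤ) with hh
  have hh0 : 0 < h := hpos i₀
  have huv : toReal u = h • (h⁻¹ • toReal u) := by
    rw [smul_smul, mul_inv_cancel₀ hh0.ne', one_smul]
  have hblock : h⁻¹ • toReal u ∈ blocker fun i => toReal (f i : Fin n → ℤ) := fun i => by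
    rw [smul_dotProduct, smul_eq_mul, inv_mul_eq_div, one_le_div hh0]
    exact hmin i (Finset.mem_univ i)
  have htight : ∃ i, (h⁻¹ • toReal u) ⬝ᵥ toReal (f i : Fin n → ℤ) = 1 :=
    ⟨i₀, by rw [smul_dotProduct, smul_eq_mul, ← hh, inv_mul_cancel₀ hh0.ne']⟩
  refine ⟨h⁻¹ • toReal u, hblock, ?_, h, hh0, huv⟩
  rw [huv, face_smul _ hh0, hf.newtonPolyhedron_eq, face_upperHull hblock htight] at hdim
  refine (finrank_vectorSpan_convexHull (u := h⁻¹ • toReal u) ?_ (Set.Nonempty.image _ htight)).1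
    hdim
  rintro _ ⟨i, hi, rfl⟩
  exact hi

lemma NewtonGenerators.supportFunction_eq (hn : 1 ≤ n) (hf : NewtonGenerators a f) {v : Fin n → ℝ}
    (hv : v ∈ blocker fun i => toReal (f i : Fin n → ℤ))
    (hvt : tightSpan (fun i => toReal (f i : Fin n → ℤ)) v = ⊤) {u : Fin n → ℤ} {c : ℝ}
    (hc : 0 < c) (huv : toReal u = c • v) :
    supportFunction (newtonPolyhedron a) (toReal u) = ENNReal.ofReal c := by
  rw [hf.newtonPolyhedron_eq, supportFunction]
  apply le_antisymm
  · obtain ⟨i, hi⟩ := tight_nonempty hn hvt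
    refine (iInf₂_le _ (mem_upperHull_self _ i)).trans ?_
    rw [huv, smul_dotProduct, hi, smul_eq_mul, mul_one]
  · refine le_iInf₂ fun x hx => ENNReal.ofReal_le_ofReal ?_
    rw [huv, smul_dotProduct, smul_eq_mul]
    exact le_mul_of_one_le_right hc.le (one_le_dotProduct_of_mem_upperHull hv hx)

/-- A vertex is determined by its set of tight indices, because the tight exponents span, and a
primitive normal by the vertex on its ray. There are finitely many index sets. -/
lemma NewtonGenerators.finite_facetNormals (hf : NewtonGenerators a f) :
    (facetNormals a).Finite := by
  classical
  choose! v hv hvt c hc huv using fun u (hu : u ∈ facetNormals a) =>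
    hf.exists_vertex_of_mem_facetNormals hu
  refine Set.Finite.of_finite_image (f := fun u => {i | v u ⬝ᵥ toReal (f i : Fin n → ℤ) = 1})
    (Set.toFinite _) fun u hu u' hu' heq => ?_
  have hvv : v u = v u' := by
    rw [← sub_eq_zero]
    refine eq_zero_of_dotProduct_eq_zero_of_span (hvt u hu) ?_
    rintro _ ⟨i, hi, rfl⟩
    have hi' : i ∈ {i | v u' ⬝ᵥ toReal (f i : Fin n → ℤ) = 1} := by
      have heq' : {i | v u ⬝ᵥ toReal (f i : Fin n → ℤ) = 1}
        = {i | v u' ⬝ᵥ toReal (f i : Fin n → ℤ) = 1} := heq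
      rw [← heq']
      exact hi
    have h1 : v u ⬝ᵥ toReal (f i : Fin n → ℤ) = 1 := hi
    have h2 : v u' ⬝ᵥ toReal (f i : Fin n → ℤ) = 1 := hi'
    rw [sub_dotProduct, h1, h2, sub_self]
  refine hu.1.eq_of_smul hu'.1 (div_pos (hc u hu) (hc u' hu')) ?_
  rw [huv u hu, huv u' hu', smul_smul, div_mul_cancel₀ _ (hc u' hu').ne', hvv]

lemma NewtonGenerators.facetNormals_nonempty (hn : 1 ≤ n) (hf : NewtonGenerators a f) :
    (facetNormals a).Nonempty := by
  obtain ⟨v, hv, hvt⟩ := exists_vertex _ hf.span_eq_top hf.zero_notMem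
  obtain ⟨u, hu, c, hc, huv⟩ := exists_primitive_normal (fun i => (f i : Fin n → ℤ)) hn hvt
  exact ⟨u, hf.mem_facetNormals hn hv hvt hu hc huv⟩

end

end AffineSemigroup

/-! ### From inclusions of ideals to inequalities between support functions. -/

/-- Density of the rationals; for `M = ∞` no ratio is admissible and the infimum of the empty set is
`∞`. -/
lemma sInf_ratio_ge (M : ℝ≥0∞) :
    sInf {r : ℝ≥0∞ | ∃ p q : ℕ, 0 < p ∧ 0 < q ∧ r = (q : ℝ≥0∞) / (p : ℝ≥0∞) ∧ M ≤ r} = M := by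
  apply le_antisymm
  · refine le_of_forall_gt fun x hx => ?_
    obtain ⟨r, hr0, hMr, hrx⟩ := ENNReal.lt_iff_exists_rat_btwn.1 hx
    refine (sInf_le ?_).trans_lt hrx
    have hr : 0 < r := by
      refine lt_of_le_of_ne hr0 fun h => ?_
      rw [← h] at hMr
      simp at hMr
    refine ⟨r.den, r.num.toNat, r.den_pos, ?_, ?_, hMr.le⟩
    · have := Rat.num_pos.2 hr
      omega
    · have h1 : (r : ℝ) = (r.num.toNat : ℝ) / (r.den : ℝ) := by
        have h2 : ((r.num.toNat : ℤ) : ℝ) = r.num := by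
          rw [Int.toNat_of_nonneg (Rat.num_nonneg.2 hr0)]
        rw [Int.cast_natCast] at h2
        rw [h2]
        exact Rat.cast_def r
      change ENNReal.ofReal (r : ℝ) = _
      rw [h1, ENNReal.ofReal_div_of_pos (by exact_mod_cast r.den_pos), ENNReal.ofReal_natCast,
        ENNReal.ofReal_natCast]
  · refine le_sInf ?_
    rintro _ ⟨p, q, -, -, -, h⟩
    exact h

namespace AffineSemigroup

variable {n : ℕ} {S : AffineSemigroup n} {k : Type*} [Field k]

lemma supportFunction_newtonPolyhedron (I : Ideal (S.localRing k)) {u : Fin n → ℝ}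
    (hu : u ∈ S.dualCone) : supportFunction (newtonPolyhedron I) u =
      ⨅ m : S.carrier, ⨅ _ : S.monomial m ∈ I, ENNReal.ofReal (u ⬝ᵥ toReal (m : Fin n → ℤ)) := by
  apply le_antisymm
  · refine le_iInf₂ fun m hm => iInf₂_le (toReal (m : Fin n → ℤ)) ?_
    exact ⟨_, subset_convexHull ℝ _ ⟨_, ⟨m.2, hm⟩, rfl⟩, 0, Submodule.zero_mem _, add_zero _⟩
  · refine le_iInf₂ ?_
    rintro _ ⟨y, hy, z, hz, rfl⟩
    set β := ⨅ m : S.carrier, ⨅ _ : S.monomial m ∈ I,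
      ENNReal.ofReal (u ⬝ᵥ toReal (m : Fin n → ℤ)) with hβ
    have hβm : ∀ m : S.carrier, S.monomial m ∈ I →
        β ≤ ENNReal.ofReal (u ⬝ᵥ toReal (m : Fin n → ℤ)) := fun m hm => iInf₂_le m hm
    -- The hull is nonempty, so some exponent exists and `β` is finite. The bound then defines a
    -- real half-space, which is convex.
    obtain ⟨-, m₀, ⟨hm₀S, hm₀⟩, rfl⟩ := convexHull_nonempty_iff.1 ⟨y, hy⟩
    have hβtop : β ≠ ⊤ := ((hβm ⟨m₀, hm₀S⟩ hm₀).trans_lt ENNReal.ofReal_lt_top).ne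
    have hyβ : β.toReal ≤ u ⬝ᵥ y := by
      have hsub : convexHull ℝ (toReal '' exponentSet I) ⊆ {y | β.toReal ≤ u ⬝ᵥ y} := by
        refine convexHull_min ?_ ?_
        · rintro _ ⟨m, ⟨hmS, hm⟩, rfl⟩
          have h0 : 0 ≤ u ⬝ᵥ toReal m := hu _ (toReal_mem_cone ⟨m, hmS⟩)
          exact (ENNReal.le_ofReal_iff_toReal_le hβtop h0).1 (hβm ⟨m, hmS⟩ hm)
        · intro x hx y hy s t hs ht hst
          have hx' : β.toReal ≤ u ⬝ᵥ x := hx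
          have hy' : β.toReal ≤ u ⬝ᵥ y := hy
          change β.toReal ≤ u ⬝ᵥ (s • x + t • y)
          rw [dotProduct_add, dotProduct_smul, dotProduct_smul, smul_eq_mul, smul_eq_mul]
          have : t = 1 - s := by linarith
          subst this
          nlinarith [mul_le_mul_of_nonneg_left hx' hs, mul_le_mul_of_nonneg_left hy' ht]
      exact hsub hy
    have h0 : 0 ≤ u ⬝ᵥ z := hu z hz
    rw [← ENNReal.ofReal_toReal hβtop]
    apply ENNReal.ofReal_le_ofReal
    rw [dotProduct_add]
    linarith

lemma le_toricValuation_of_mem {I : Ideal (S.localRing k)} (hI : IsMonomial I) {u : Fin n → ℤ}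
    (hu : ∀ m : S.carrier, m ≠ 0 → 0 < u ⬝ᵥ (m : Fin n → ℤ)) {x : S.localRing k} (hx : x ∈ I) :
    (⨅ m : S.carrier, ⨅ _ : S.monomial m ∈ I,
      ENNReal.ofReal (toReal u ⬝ᵥ toReal (m : Fin n → ℤ))) ≤ toricValuation k hu x := by
  obtain ⟨E, hE⟩ := hI
  have hEI : ∀ m ∈ E, S.monomial m ∈ I := fun m hm => by
    rw [hE]; exact Ideal.subset_span ⟨m, hm, rfl⟩
  rw [hE] at hx
  induction hx using Submodule.span_induction with
  | mem x hx =>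
    obtain ⟨m, hm, rfl⟩ := hx
    rw [toricValuation_monomial]
    exact iInf₂_le m (hEI m hm)
  | zero => simp
  | add x y _ _ hx hy => exact (le_min hx hy).trans ((toricValuation k hu).map_add x y)
  | smul r x _ hx =>
    rw [smul_eq_mul, AddValuation.map_mul]
    exact hx.trans le_add_self

lemma valIdeal_toricValuation {I : Ideal (S.localRing k)} (hI : IsMonomial I) {u : Fin n → ℤ}
    (hdual : toReal u ∈ S.dualCone)
    (hu : ∀ m : S.carrier, m ≠ 0 → 0 < u ⬝ᵥ (m : Fin n → ℤ)) :
    valIdeal (toricValuation k hu) I = supportFunction (newtonPolyhedron I) (toReal u) := by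
  rw [supportFunction_newtonPolyhedron I hdual]
  apply le_antisymm
  · refine le_iInf₂ fun m hm => ?_
    rw [← toricValuation_monomial k hu]
    exact iInf₂_le _ hm
  · exact le_iInf₂ fun x hx => le_toricValuation_of_mem hI hu hx

lemma monomial_sum {ι : Type*} (s : Finset ι) (f : ι → S.carrier) :
    (S.monomial (∑ i ∈ s, f i) : S.localRing k) = ∏ i ∈ s, S.monomial (f i) := by
  classical
  induction s using Finset.induction_on with
  | empty => simp [monomial_zero]
  | insert i s hi ih => rw [Finset.sum_insert hi, Finset.prod_insert hi, monomial_add, ih]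

section

variable {a : Ideal (S.localRing k)} {ι : Type*} [Fintype ι] {f : ι → S.carrier}

/-- Monomials whose exponents lie in the `N`-th multiple of the Newton polyhedron are integral over
the `N`-th power of the ideal. -/
lemma NewtonGenerators.monomial_mem_idealIntegralClosure (hf : NewtonGenerators a f) {N : ℕ}
    (m : S.carrier) {c : ι → ℝ} (hc : ∀ i, 0 ≤ c i) (hcN : (N : ℝ) ≤ ∑ i, c i)
    (hm : toReal (m : Fin n → ℤ) = ∑ i, c i • toReal (f i : Fin n → ℤ)) :
    S.monomial m ∈ idealIntegralClosure (a ^ N) := by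
  -- Homogenize: the extra coordinate `none` counts factors of `a`, and the extra generator with
  -- entry `-1` there absorbs the surplus `∑ c i - N`. Integral coefficients thus still satisfy `∑ d
  -- i ≥ D N`.
  let z : Option ι → Option (Fin n) → ℤ := fun i j =>
    i.elim (j.elim (-1) fun _ => 0) fun i => j.elim 1 (f i : Fin n → ℤ)
  let w : Option (Fin n) → ℤ := fun j => j.elim (N : ℤ) (m : Fin n → ℤ)
  let c' : Option ι → ℝ := fun i => i.elim (∑ i, c i - N) c
  obtain ⟨D, hD, d, hd⟩ := exists_pos_mul_eq_sum z w (c := c')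
    (by rintro (_ | i); exacts [sub_nonneg.2 hcN, hc i]) (by
      rintro (_ | j)
      · simp [z, w, c', Fintype.sum_option]
      · have := congrFun hm j
        simpa [z, w, c', Fintype.sum_option, toReal, Finset.sum_apply] using this)
  have hN : D * N ≤ ∑ i, d (some i) := by
    have := hd none
    simp only [z, w, Fintype.sum_option, Option.elim] at this
    have h2 : ((D * N : ℕ) : ℤ) ≤ ((∑ i, d (some i) : ℕ) : ℤ) := by
      push_cast
      have h3 : ∑ x, (d (some x) : ℤ) * 1 = ∑ x, (d (some x) : ℤ) := by simp
      rw [h3] at this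
      have : (0 : ℤ) ≤ d none := by positivity
      linarith
    exact_mod_cast h2
  have hDm : D • m = ∑ i, d (some i) • f i := by
    apply Subtype.ext
    ext j
    have := hd (some j)
    simp only [z, w, Fintype.sum_option, Option.elim] at this
    simpa [Finset.sum_apply] using this
  refine mem_idealIntegralClosure_of_pow_mem hD ?_
  rw [← monomial_nsmul, hDm, monomial_sum, ← pow_mul, mul_comm N D]
  refine Ideal.pow_le_pow_right hN ?_
  rw [← Finset.prod_pow_eq_pow_sum]
  refine Ideal.prod_mem_prod fun i _ => ?_
  rw [monomial_nsmul]
  exact Ideal.pow_mem_pow (hf.monomial_mem i) _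

/-- Test `m / N` at the vertices `v` of the blocker. Each `v` has a primitive multiple `u = e • v`
in `facetNormals a`, for which the support function is `e`, so the hypothesis at `u` reads `N ≤ v ⬝ᵥ
m`. -/
lemma NewtonGenerators.monomial_mem_idealIntegralClosure_of_facets (hn : 1 ≤ n)
    (hf : NewtonGenerators a f) {N : ℕ} (hN : 0 < N) (m : S.carrier)
    (hm : ∀ u ∈ facetNormals a, N * supportFunction (newtonPolyhedron a) (toReal u)
      ≤ ENNReal.ofReal (toReal u ⬝ᵥ toReal (m : Fin n → ℤ))) :
    S.monomial m ∈ idealIntegralClosure (a ^ N) := by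
  have hN' : (0 : ℝ) < N := by exact_mod_cast hN
  obtain ⟨c, hc, hmc⟩ := hf.exists_cone _ (toReal_mem_cone m)
  have hmem : ∑ i, ((N : ℝ)⁻¹ * c i) • toReal (f i : Fin n → ℤ) ∈
      upperHull fun i => toReal (f i : Fin n → ℤ) := by
    refine mem_upperHull_of_forall_vertex _ hf.span_eq_top hf.zero_notMem
      (fun i => mul_nonneg (inv_nonneg.2 hN'.le) (hc i)) fun v hv hvt => ?_
    obtain ⟨u, hu, e, he, huv⟩ := exists_primitive_normal (fun i => (f i : Fin n → ℤ)) hn hvt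
    have h1 := hm u (hf.mem_facetNormals hn hv hvt hu he huv)
    rw [hf.supportFunction_eq hn hv hvt he huv, ← ENNReal.ofReal_natCast,
      ← ENNReal.ofReal_mul hN'.le, huv, smul_dotProduct, smul_eq_mul] at h1
    have h2 : 0 ≤ v ⬝ᵥ toReal (m : Fin n → ℤ) :=
      mem_dualCone_of_blocker hf (fun i => zero_le_one.trans (hv i)) _ (toReal_mem_cone m)
    rw [ENNReal.ofReal_le_ofReal_iff (mul_nonneg he.le h2), mul_comm, mul_le_mul_iff_right₀ he]
      at h1
    simp_rw [mul_smul]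
    rw [← Finset.smul_sum, ← hmc, dotProduct_smul, smul_eq_mul, inv_mul_eq_div, one_le_div hN']
    exact h1
  obtain ⟨d, hd, hd1, hsum⟩ := hmem
  refine hf.monomial_mem_idealIntegralClosure m (c := fun i => N * d i)
    (fun i => mul_nonneg hN'.le (hd i)) ?_ ?_
  · rw [← Finset.mul_sum]
    exact le_mul_of_one_le_right hN'.le hd1
  · simp_rw [mul_smul]
    rw [← Finset.smul_sum, ← hsum]
    simp_rw [mul_smul]
    rw [← Finset.smul_sum, ← hmc, smul_smul, mul_inv_cancel₀ hN'.ne', one_smul]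

/-- The powers of a monomial ideal are generated by monomials satisfying the obvious bounds. -/
lemma pow_le_span_monomial {b : Ideal (S.localRing k)} (hb : IsMonomial b) {U : Set (Fin n → ℤ)}
    (hU : ∀ u ∈ U, toReal u ∈ S.dualCone) (j : ℕ) :
    b ^ j ≤ Ideal.span (S.monomial '' {m | ∀ u ∈ U,
      j * supportFunction (newtonPolyhedron b) (toReal u)
        ≤ ENNReal.ofReal (toReal u ⬝ᵥ toReal (m : Fin n → ℤ))}) := by
  obtain ⟨E, hE⟩ := hb
  have hEb : ∀ m ∈ E, ∀ u ∈ U, supportFunction (newtonPolyhedron b) (toReal u)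
      ≤ ENNReal.ofReal (toReal u ⬝ᵥ toReal (m : Fin n → ℤ)) := by
    intro m hm u hu
    rw [supportFunction_newtonPolyhedron b (hU u hu)]
    exact iInf₂_le m (by rw [hE]; exact Ideal.subset_span ⟨m, hm, rfl⟩)
  induction j with
  | zero =>
    rw [pow_zero, Ideal.one_eq_top, top_le_iff, Ideal.eq_top_iff_one]
    exact Ideal.subset_span ⟨0, fun u hu => by simp, monomial_zero k⟩
  | succ j ih =>
    rw [pow_succ]
    conv_lhs => rw [hE]
    rw [hE] at ih hEb
    refine (Ideal.mul_mono_left ih).trans ?_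
    rw [Ideal.span_mul_span', Ideal.span_le, hE]
    rintro _ ⟨_, ⟨m, hm, rfl⟩, _, ⟨m', hm', rfl⟩, rfl⟩
    refine Ideal.subset_span ⟨m + m', fun u hu => ?_, monomial_add k m m'⟩
    rw [AddSubmonoid.coe_add, toReal_add, dotProduct_add,
      ENNReal.ofReal_add (hU u hu _ (toReal_mem_cone m)) (hU u hu _ (toReal_mem_cone m'))]
    push_cast
    rw [add_mul, one_mul]
    exact add_le_add (hm u hu) (hEb m' hm' u hu)

/-- The factor `t` cancels: one positive `t` already yields the inequalities, by evaluating `v_u` on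
`(χ^m) ^ (q t)` for `χ^m ∈ b`, and the inequalities yield the inclusion for every positive `t`. -/
lemma NewtonGenerators.eventually_subset_iff (hn : 1 ≤ n) (hf : NewtonGenerators a f)
    (ha : IsMonomial a) {b : Ideal (S.localRing k)} (hb : IsMonomial b) {p q : ℕ} (hp : 0 < p)
    (hq : 0 < q) :
    (∀ᶠ t : ℕ in Filter.atTop,
      ((b ^ (q * t) : Ideal (S.localRing k)) : Set (S.localRing k)) ⊆
        idealIntegralClosure (a ^ (p * t))) ↔
    ∀ u ∈ facetNormals a, supportFunction (newtonPolyhedron a) (toReal u) /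
      supportFunction (newtonPolyhedron b) (toReal u) ≤ (q : ℝ≥0∞) / (p : ℝ≥0∞) := by
  have hratio : ∀ u ∈ facetNormals a, (supportFunction (newtonPolyhedron a) (toReal u) /
      supportFunction (newtonPolyhedron b) (toReal u) ≤ (q : ℝ≥0∞) / (p : ℝ≥0∞) ↔
      p * supportFunction (newtonPolyhedron a) (toReal u) ≤
        q * supportFunction (newtonPolyhedron b) (toReal u)) := by
    intro u hu
    obtain ⟨v, hv, hvt, c, hc, huv⟩ := hf.exists_vertex_of_mem_facetNormals hu
    have hq0 : (q : ℝ≥0∞) ≠ 0 := by exact_mod_cast hq.ne'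
    have hp0 : (p : ℝ≥0∞) ≠ 0 := by exact_mod_cast hp.ne'
    have hqp0 : (q : ℝ≥0∞) / p ≠ 0 := ENNReal.div_ne_zero.2 ⟨hq0, by simp⟩
    have hqpt : (q : ℝ≥0∞) / p ≠ ⊤ := ENNReal.div_ne_top (by simp) hp0
    rw [hf.supportFunction_eq hn hv hvt hc huv]
    -- As `q / p` is neither `0` nor `∞`, clearing denominators remains valid when the support
    -- function of `b` is `0` (for `b = R`) or `∞` (for `b = 0`).
    rw [ENNReal.div_le_iff_le_mul (Or.inr hqpt) (Or.inr hqp0), ENNReal.mul_comm_div, mul_comm (p : ℝ≥0∞),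
      ← mul_div_assoc, ENNReal.le_div_iff_mul_le (Or.inl hp0) (Or.inl (by simp))]
  rw [forall₂_congr hratio]
  constructor
  · intro h u hu
    obtain ⟨t, ht, htpos⟩ := (h.and (Filter.eventually_gt_atTop 0)).exists
    have hpos := hf.dotProduct_pos_of_ne_zero hu
    have ht0 : (t : ℝ≥0∞) ≠ 0 := by exact_mod_cast htpos.ne'
    rw [supportFunction_newtonPolyhedron b hu.2.1]
    simp_rw [ENNReal.mul_iInf_of_ne (a := (q : ℝ≥0∞)) (by exact_mod_cast hq.ne') (by simp)]
    refine le_iInf₂ fun m hm => ?_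
    have h1 := ht (Ideal.pow_mem_pow hm (q * t))
    have h2 : ∀ x ∈ a ^ (p * t), ((p * t : ℕ) : ℝ≥0∞) *
        supportFunction (newtonPolyhedron a) (toReal u) ≤ toricValuation k hpos x := fun x hx =>
      le_of_mem_pow _ (fun y hy => by
        rw [supportFunction_newtonPolyhedron a hu.2.1]
        exact le_toricValuation_of_mem ha hpos hy) _ hx
    have h3 := le_of_mem_idealIntegralClosure _ h2 h1
    rw [AddValuation.map_pow, toricValuation_monomial, nsmul_eq_mul] at h3
    push_cast at h3
    rw [mul_comm (p : ℝ≥0∞), mul_comm (q : ℝ≥0∞), mul_assoc, mul_assoc] at h3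
    exact (ENNReal.mul_le_mul_iff_right ht0 (by simp)).1 h3
  · intro h
    filter_upwards [Filter.eventually_gt_atTop 0] with t ht
    suffices H : b ^ (q * t) ≤ integralClosureIdeal (a ^ (p * t)) from H
    refine (pow_le_span_monomial hb (fun u hu => hu.2.1) (U := facetNormals a) (q * t)).trans ?_
    rw [Ideal.span_le]
    rintro _ ⟨m, hm, rfl⟩
    refine hf.monomial_mem_idealIntegralClosure_of_facets hn (Nat.mul_pos hp ht) m fun u hu =>
      le_trans ?_ (hm u hu)
    push_cast
    rw [mul_comm (p : ℝ≥0∞), mul_comm (q : ℝ≥0∞), mul_assoc, mul_assoc]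
    exact mul_le_mul_right (h u hu) _

end

end AffineSemigroup

end Lojasiewicz

end

theorem mainTheorem11 {n : ℕ} (hn : 1 ≤ n) (S : Lojasiewicz.AffineSemigroup n)
    {k : Type*} [Field k] (a b : Ideal (S.localRing k))
    (ha : Lojasiewicz.AffineSemigroup.IsMonomial a)
    (hb : Lojasiewicz.AffineSemigroup.IsMonomial b)
    (ha_primary : a.IsPrimary)
    (ha_radical : a.radical = IsLocalRing.maximalIdeal (S.localRing k)) :
    (Lojasiewicz.facetNormals a).Finite ∧
    IsGreatest
      ((fun u : Fin n → ℤ =>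
        Lojasiewicz.supportFunction (Lojasiewicz.AffineSemigroup.newtonPolyhedron a)
            (Lojasiewicz.toReal u) /
          Lojasiewicz.supportFunction (Lojasiewicz.AffineSemigroup.newtonPolyhedron b)
            (Lojasiewicz.toReal u)) '' Lojasiewicz.facetNormals a)
      (Lojasiewicz.loj b a) ∧
    ∃ u ∈ Lojasiewicz.facetNormals a, ∃ v : AddValuation (S.localRing k) ENNReal,
      S.IsToricValuation u v ∧ Lojasiewicz.IsCentered v ∧ Lojasiewicz.IsDivisorial v ∧
        Lojasiewicz.loj b a = Lojasiewicz.valIdeal v a / Lojasiewicz.valIdeal v b := by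
  obtain ⟨ι, _, f, hf⟩ := Lojasiewicz.AffineSemigroup.exists_newtonGenerators a ha_radical
  have hfin := hf.finite_facetNormals
  obtain ⟨u, hu, hmax⟩ := Set.exists_max_image _ (fun u : Fin n → ℤ =>
    Lojasiewicz.supportFunction (Lojasiewicz.AffineSemigroup.newtonPolyhedron a)
        (Lojasiewicz.toReal u) /
      Lojasiewicz.supportFunction (Lojasiewicz.AffineSemigroup.newtonPolyhedron b)
        (Lojasiewicz.toReal u)) hfin (hf.facetNormals_nonempty hn)
  have hloj : Lojasiewicz.loj b a =
      Lojasiewicz.supportFunction (Lojasiewicz.AffineSemigroup.newtonPolyhedron a)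
          (Lojasiewicz.toReal u) /
        Lojasiewicz.supportFunction (Lojasiewicz.AffineSemigroup.newtonPolyhedron b)
          (Lojasiewicz.toReal u) := by
    -- Expressing the maximum as an infimum of ratios above it makes both sides infima over the same
    -- set.
    rw [← Lojasiewicz.sInf_ratio_ge (Lojasiewicz.supportFunction _ _ /
      Lojasiewicz.supportFunction (Lojasiewicz.AffineSemigroup.newtonPolyhedron b) _),
      Lojasiewicz.loj, Lojasiewicz.lojFiltration]
    congr 1
    ext r
    refine exists₂_congr fun p q => and_congr_right fun hp => and_congr_right fun hq =>
      and_congr_right fun hr => ?_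
    rw [hf.eventually_subset_iff hn ha hb hp hq, hr]
    exact ⟨fun h => h u hu, fun h w hw => (hmax w hw).trans h⟩
  refine ⟨hfin, ⟨⟨u, hu, hloj.symm⟩, ?_⟩, ?_⟩
  · rintro _ ⟨w, hw, rfl⟩
    rw [hloj]
    exact hmax w hw
  · have hpos := hf.dotProduct_pos_of_ne_zero hu
    -- Only an index is needed: `f i` is a nonzero element of `S`, which makes the valuation
    -- nontrivial.
    obtain ⟨i, -⟩ := hf.exists_vertex_of_mem_facetNormals hu |>.choose_spec.2.1 |>
      Lojasiewicz.tight_nonempty hn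
    refine ⟨u, hu, Lojasiewicz.AffineSemigroup.toricValuation k hpos,
      Lojasiewicz.AffineSemigroup.isToricValuation_toricValuation k hpos,
      Lojasiewicz.AffineSemigroup.isCentered_toricValuation k hpos,
      Lojasiewicz.AffineSemigroup.isDivisorial_toricValuation k hpos ⟨f i, hf.ne_zero i⟩, ?_⟩
    rw [Lojasiewicz.AffineSemigroup.valIdeal_toricValuation ha hu.2.1,
      Lojasiewicz.AffineSemigroup.valIdeal_toricValuation hb hu.2.1, hloj]
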